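/- **Proposition 3.1.** Let $0\le t_0<t_*<t_f<T$ and let $u(x,t)$ be a weak (distributional) solution of the inviscid Burgers equation $u_t+(u^2/2)_x=0$ on $\mathbb{R}\times(0,T)$, with $u,u^2$ locally integrable. Suppose that a single admissible shock forms at time $t_*$ and does not merge with another shock by time $t_f$, in the following sense. There is a curve $x_*:[t_*,T)\to\mathbb{R}$, continuous on $[t_*,T)$ and $C^1$ on $(t_*,T)$, along which, for every $\tau\in(t_*,T)$, $u$ and $u'=\partial_x u$ have limits $u_\pm(\tau)$ and $u'_\pm(\tau)$ as the point $(x_*(\tau),\tau)$ is approached in space-time from the right ($+$) and from the left ($-$) of the curve, with $u_-(\tau)>u_+(\tau)$. Let $u_\pm(t_*)=u(x_*(t_*)\pm,t_*)$, $x_*^f=x_*(t_f)$, $u_\pm^f=u_\pm(t_f)$, and let $$\Delta=\{(x,t):\ 0\le t\le t_f,\ \ x_*^f+u_-^f\,(t-t_f)\le x\le x_*^f+u_+^f\,(t-t_f)\}$$ be the set of space-time positions of the particles that end in the shock at time $t_f$. On some open neighbourhood of $\Delta$, $u$ is $C^1$ at times in $(0,T)$ off the shock curve and its starting point $(x_*(t_*),t_*)$,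 and $u$ is continuous at times in $[0,T)$ off the points $(x_*(\tau),\tau)$, $t_*<\tau<T$ (in particular, down to time $0$ and at $(x_*(t_*),t_*)$). Put $\bar u(x,t)=\tfrac12\,(u(x+,t)+u(x-,t))$ and let $u_*(\tau)=\tfrac12(u_-(\tau)+u_+(\tau))$ be the shock velocity, $u_*^f=u_*(t_f)$. The geometric backward stochastic process ending at $(x_*^f,t_f)$ has the realizations $$x_\pm(t;\tau)=\begin{cases}x_*(t), & t\ge\tau,\\ x_*(\tau)+u_\pm(\tau)\,(t-\tau), & t<\tau,\end{cases}\qquad \tau\in[t_*,t_f],$$ where the side $\pm$ and the time $\tau$ are random, with joint density $$p_\pm(\tau)=\frac{(u_-(\tau)-u_+(\tau))\,\bigl(1-u'_\pm(\tau)(\tau-t_0)\bigr)}{2\,(u_-^f-u_+^f)\,(t_f-t_0)},\qquad \tau\in(t_*,t_f].$$ Then: 1. $p_\pm\ge 0$ on $(t_*,t_f]$ and $\int_{t_*}^{t_f}\bigl(p_+(\tau)+p_-(\tau)\bigr)\,d\tau=1$, so that this is a probability law. 2. Every realization has at every time $t\in[0,t_f]$ a right-hand derivative $\dot x(t)=D_t^+x(t)$,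 and $\dot x(t)=\bar u(x(t),t)$. 3. For every $t\in[0,t_f]$ the random variable $\dot x(t)$ is integrable, and $$\mathbb{E}(\dot x(t))=u_*^f .$$ -/

import Mathlib

open Set Filter Topology MeasureTheory

noncomputable section

namespace BurgersShock

/-- A field `u x t` is a weak (distributional) solution of the inviscid Burgers equation
`u_t + (u ^ 2 / 2)_x = 0` on the strip `ℝ × (0, T)`. Space-time points are pairs `(x, t)`. -/
structure IsWeakSolution (u : ℝ → ℝ → ℝ) (T : ℝ) : Prop where
  locallyIntegrable :
    LocallyIntegrableOn (fun z : ℝ × ℝ => u z.1 z.2) (univ ×ˢ Ioo 0 T)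
  locallyIntegrable_sq :
    LocallyIntegrableOn (fun z : ℝ × ℝ => u z.1 z.2 ^ 2) (univ ×ˢ Ioo 0 T)
  weak : ∀ φ : ℝ × ℝ → ℝ, ContDiff ℝ (⊤ : ℕ∞) φ → HasCompactSupport φ →
    tsupport φ ⊆ univ ×ˢ Ioo 0 T →
    ∫ z : ℝ × ℝ, (u z.1 z.2 * fderiv ℝ φ z (0, 1)
      + u z.1 z.2 ^ 2 / 2 * fderiv ℝ φ z (1, 0)) = 0

/-- The one-sided velocity at the curve `xs`: `u_+(τ) = u(xs(τ)+, τ)` (right, `σ = true`) and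
`u_-(τ) = u(xs(τ)-, τ)` (left, `σ = false`). -/
def sideVel (u : ℝ → ℝ → ℝ) (xs : ℝ → ℝ) : Bool → ℝ → ℝ
  | true, τ => Function.rightLim (fun x => u x τ) (xs τ)
  | false, τ => Function.leftLim (fun x => u x τ) (xs τ)

/-- The one-sided velocity gradient `u'_±(τ) = u'(xs(τ) ± 0, τ)` at the curve `xs`. -/
def sideGrad (u : ℝ → ℝ → ℝ) (xs : ℝ → ℝ) : Bool → ℝ → ℝ
  | true, τ => Function.rightLim (deriv fun x => u x τ) (xs τ)
  | false, τ => Function.leftLim (deriv fun x => u x τ) (xs τ)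

/-- `ū(x, t) = (u(x+, t) + u(x-, t)) / 2`. -/
def uBar (u : ℝ → ℝ → ℝ) (x t : ℝ) : ℝ :=
  (Function.rightLim (fun y => u y t) x + Function.leftLim (fun y => u y t) x) / 2

/-- The shock velocity `u_*(τ) = (u_-(τ) + u_+(τ)) / 2`. -/
def shockVel (u : ℝ → ℝ → ℝ) (xs : ℝ → ℝ) (τ : ℝ) : ℝ :=
  (sideVel u xs false τ + sideVel u xs true τ) / 2

/-- The shock set in space-time (without the formation point). -/
def shockSet (xs : ℝ → ℝ) (ts T : ℝ) : Set (ℝ × ℝ) :=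
  {z | z.2 ∈ Ioo ts T ∧ z.1 = xs z.2}

/-- The region adjacent to the shock on its right (`true`) or on its left (`false`). -/
def sideSet (xs : ℝ → ℝ) (ts T : ℝ) : Bool → Set (ℝ × ℝ)
  | true => {z | z.2 ∈ Ioo ts T ∧ xs z.2 < z.1}
  | false => {z | z.2 ∈ Ioo ts T ∧ z.1 < xs z.2}

/-- The space-time region of the particles which end in the shock at time `tf`: its section at
time `t` is the interval `[c_-, c_+]` cut out by the two straight characteristics that enter the
shock at time `tf` from the left and from the right. -/
def shockTriangle (u : ℝ → ℝ → ℝ) (xs : ℝ → ℝ) (tf : ℝ) : Set (ℝ × ℝ) :=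
  {z | z.2 ∈ Icc 0 tf ∧
    z.1 ∈ Icc (xs tf + sideVel u xs false tf * (z.2 - tf))
      (xs tf + sideVel u xs true tf * (z.2 - tf))}

/-- The curve `xs` is an entropy shock of `u` that forms at time `ts`, lives on `(ts, T)`, and has
not merged with any other shock by the time `tf`: near the region of the particles which end in the
shock at time `tf`, the field `u` is `C¹` for positive times off the curve, and continuous down to
time `0` and at the formation point. -/
structure IsSingleShock (u : ℝ → ℝ → ℝ) (xs : ℝ → ℝ) (ts tf T : ℝ) : Prop where
  continuousOn_curve : ContinuousOn xs (Ico ts T)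
  contDiffOn_curve : ContDiffOn ℝ 1 xs (Ioo ts T)
  /-- `u` has one-sided limits along the curve. -/
  tendsto_vel : ∀ σ, ∀ τ ∈ Ioo ts T,
    Tendsto (fun z : ℝ × ℝ => u z.1 z.2) (𝓝[sideSet xs ts T σ] (xs τ, τ))
      (𝓝 (sideVel u xs σ τ))
  /-- `∂u/∂x` has one-sided limits along the curve. -/
  tendsto_grad : ∀ σ, ∀ τ ∈ Ioo ts T,
    Tendsto (fun z : ℝ × ℝ => deriv (fun y => u y z.2) z.1) (𝓝[sideSet xs ts T σ] (xs τ, τ))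
      (𝓝 (sideGrad u xs σ τ))
  /-- The admissibility condition `u_- > u_+`. -/
  admissible : ∀ τ ∈ Ioo ts T, sideVel u xs true τ < sideVel u xs false τ
  regular : ∃ U : Set (ℝ × ℝ), IsOpen U ∧ shockTriangle u xs tf ⊆ U ∧
    ContinuousOn (fun z : ℝ × ℝ => u z.1 z.2)
      ((U ∩ {z | z.2 ∈ Ico 0 T}) \ shockSet xs ts T) ∧
    ContDiffOn ℝ 1 (fun z : ℝ × ℝ => u z.1 z.2)
      ((U ∩ {z | z.2 ∈ Ioo 0 T}) \ (shockSet xs ts T ∪ {(xs ts, ts)}))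

/-- The realizations `x_±(t; τ)` of the process, for `ω = (±, τ)`: follow the shock at times
`t ≥ τ`, and the straight characteristic on the chosen side of it at times `t < τ`. -/
def path (u : ℝ → ℝ → ℝ) (xs : ℝ → ℝ) (ω : Bool × ℝ) (t : ℝ) : ℝ :=
  if ω.2 ≤ t then xs t else xs ω.2 + sideVel u xs ω.1 ω.2 * (t - ω.2)

/-- The densities `p_±(τ)` to leave the shock, backward in time, to the right or left at
time `τ`. -/
def branchDensity (u : ℝ → ℝ → ℝ) (xs : ℝ → ℝ) (t0 tf : ℝ) (σ : Bool) (τ : ℝ) : ℝ :=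
  ((sideVel u xs false τ - sideVel u xs true τ) * (1 - sideGrad u xs σ τ * (τ - t0))) /
    (2 * (sideVel u xs false tf - sideVel u xs true tf) * (tf - t0))

/-- The law of the branching side and time: density `p_±(τ)` on `{+, -} × [ts, tf]`. -/
def law (u : ℝ → ℝ → ℝ) (xs : ℝ → ℝ) (t0 ts tf : ℝ) : Measure (Bool × ℝ) :=
  ((Measure.count : Measure Bool).prod (volume.restrict (Icc ts tf))).withDensity
    fun ω => ENNReal.ofReal (branchDensity u xs t0 tf ω.1 ω.2)

/-- The velocity of the process: the right-hand time derivative `D_t^+ x(t)` of its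
realization. -/
def velocity (u : ℝ → ℝ → ℝ) (xs : ℝ → ℝ) (t : ℝ) (ω : Bool × ℝ) : ℝ :=
  derivWithin (path u xs ω) (Ici t) t

end BurgersShock

end

/-!
The proof follows the particles of the Burgers flow backward in time along their characteristics.

Blowing up the weak formulation at a point of the shock gives the Rankine–Hugoniot condition
`xs' = u_*` (`IsWeakSolution.rankine_hugoniot`), so with `u_- > u_+` characteristics enter the shock
strictly from both sides; where `u` is `C¹` the equation holds pointwise
(`IsWeakSolution.fderiv_eq_zero`), so `u` is constant along a characteristic as long as this stays
in the smooth region (`ShockSetup.eq_sideVel_of_mem`). That it does stay there, back to time `0`, is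
the geometric core: it can meet neither the shock, since it would have to leave the shock with the
velocity of its own side (`ShockSetup.side_charLine_pos_of_forall`), nor another characteristic,
since the two would carry the same value and coincide (`ShockSetup.side_mul_charLine_sub_pos`), nor
the formation point, through which all earlier characteristics would be squeezed
(`ShockSetup.side_charLine_ts_pos`). Hence the field at `x_±(t; τ)`, `t < τ`, is `u_±(τ)`, and at a
fixed time the characteristics of one side are ordered by `τ`.

Differentiating the traces along the shock gives `u_±' = (u_* - u_±) u'_±`
(`ShockSetup.hasDerivAt_sideVel`). So `±p_±(τ)` is, up to the constant
`(u_-^f - u_+^f) (t_f - t_0)`, the `τ`-derivative of the position at time `t_0` of the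
characteristic that enters the shock at time `τ`: the density is nonnegative by the ordering, and
it integrates to `1` because the two families start at the same point for `τ = t_*` and bound the
triangle for `τ = t_f`. The same computation shows that `u_* (u_- - u_+) (τ - t_0)`, the momentum
of the absorbed mass, has derivative proportional to `u_+ p_+ + u_- p_-`
(`ShockSetup.hasDerivAt_absorbedMomentum`); the expected velocity at time `t` is this momentum at
time `t` plus what is absorbed later, that is, the momentum at time `t_f`.
-/

namespace BurgersShock

/-! ### The equation in regions where the field is smooth -/

/-- A weak solution satisfies the equation pointwise where it is `C¹`. -/
theorem IsWeakSolution.fderiv_eq_zero {u : ℝ → ℝ → ℝ} {T : ℝ} (hu : IsWeakSolution u T)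
    {V : Set (ℝ × ℝ)} (hV : IsOpen V) (hVT : V ⊆ univ ×ˢ Ioo 0 T)
    (hC : ContDiffOn ℝ 1 (fun z : ℝ × ℝ => u z.1 z.2) V) {p : ℝ × ℝ} (hp : p ∈ V) :
    fderiv ℝ (fun z : ℝ × ℝ => u z.1 z.2) p (0, 1)
      + u p.1 p.2 * fderiv ℝ (fun z : ℝ × ℝ => u z.1 z.2) p (1, 0) = 0 := by
  set f : ℝ × ℝ → ℝ := fun z => u z.1 z.2 with hf
  set g : ℝ × ℝ → ℝ := fun z => fderiv ℝ f z (0, 1) + f z * fderiv ℝ f z (1, 0) with hg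
  change g p = 0
  by_contra hne
  have hfc : ContinuousOn f V := hC.continuousOn
  have hf' : ContinuousOn (fderiv ℝ f) V := hC.continuousOn_fderiv_of_isOpen hV le_rfl
  have hf1 : ContinuousOn (fun z => fderiv ℝ f z (0, 1)) V := hf'.clm_apply continuousOn_const
  have hf2 : ContinuousOn (fun z => fderiv ℝ f z (1, 0)) V := hf'.clm_apply continuousOn_const
  have hgc : ContinuousOn g V := hf1.add (hfc.mul hf2)
  -- near `p` the residual `g` has a constant sign
  have hpos : ∀ᶠ z in 𝓝 p, z ∈ V ∧ 0 < g p * g z := by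
    have h1 : ContinuousAt (fun z => g p * g z) p :=
      continuousAt_const.mul (hgc.continuousAt (hV.mem_nhds hp))
    have h2 : ∀ᶠ z in 𝓝 p, z ∈ V := hV.mem_nhds hp
    exact h2.and (h1.eventually (lt_mem_nhds (mul_self_pos.2 hne)))
  obtain ⟨r, hr, hball⟩ := Metric.eventually_nhds_iff_ball.1 hpos
  let φ : ContDiffBump p := ⟨r / 4, r / 2, by positivity, by linarith⟩
  have hφs : tsupport φ ⊆ Metric.ball p r := by
    rw [φ.tsupport_eq]
    exact Metric.closedBall_subset_ball (by change r / 2 < r; linarith)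
  have hφV : tsupport φ ⊆ V := fun z hz => (hball z (hφs hz)).1
  have hφ1 : ∀ v, Continuous fun z => fderiv ℝ φ z v := fun v =>
    ((φ.contDiff (n := 1)).continuous_fderiv one_ne_zero).clm_apply continuous_const
  have hφ2 : ∀ v, tsupport (fun z => fderiv ℝ φ z v) ⊆ tsupport φ :=
    tsupport_fderiv_apply_subset ℝ
  have hcont : ∀ h k : ℝ × ℝ → ℝ, ContinuousOn h V → Continuous k → tsupport k ⊆ tsupport φ →
      Continuous (fun z => h z * k z) ∧ HasCompactSupport (fun z => h z * k z) := by
    intro h k hh hk hks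
    have hs : tsupport (fun z => h z * k z) ⊆ tsupport φ := tsupport_mul_subset_right.trans hks
    exact ⟨(hh.mul hk.continuousOn).continuous_of_tsupport_subset hV (hs.trans hφV),
      φ.hasCompactSupport.of_isClosed_subset (isClosed_tsupport _) hs⟩
  have hint : ∀ h k : ℝ × ℝ → ℝ, ContinuousOn h V → Continuous k → tsupport k ⊆ tsupport φ →
      Integrable (fun z => h z * k z) := fun h k hh hk hks =>
    (hcont h k hh hk hks).1.integrable_of_hasCompactSupport (hcont h k hh hk hks).2
  have hdiff : ∀ z ∈ tsupport φ, DifferentiableAt ℝ f z := fun z hz =>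
    (hC.differentiableOn one_ne_zero).differentiableAt (hV.mem_nhds (hφV hz))
  have hdφ : Differentiable ℝ φ := (φ.contDiff (n := 1)).differentiable one_ne_zero
  have e1 := integral_mul_fderiv_eq_neg_fderiv_mul_of_integrable (v := ((0 : ℝ), (1 : ℝ)))
    (hint _ _ hf1 φ.continuous subset_rfl) (hint _ _ hfc (hφ1 _) (hφ2 _))
    (hint _ _ hfc φ.continuous subset_rfl) hdiff (fun z _ => hdφ z)
  have hsq : ∀ z ∈ V, fderiv ℝ (fun z => f z ^ 2 / 2) z (1, 0) = f z * fderiv ℝ f z (1, 0) := by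
    intro z hz
    have h1 : HasFDerivAt f (fderiv ℝ f z) z :=
      ((hC.differentiableOn one_ne_zero).differentiableAt (hV.mem_nhds hz)).hasFDerivAt
    have h2 := (h1.pow 2).const_mul (2⁻¹ : ℝ)
    have h3 : (fun z => f z ^ 2 / 2) = fun z => 2⁻¹ * f z ^ 2 := by ext z; ring
    rw [h3, h2.fderiv]
    simp
    ring
  have hf3 : ContinuousOn (fun z => fderiv ℝ (fun z => f z ^ 2 / 2) z (1, 0)) V :=
    (hfc.mul hf2).congr hsq
  have hfc2 : ContinuousOn (fun z => f z ^ 2 / 2) V := (hfc.pow 2).div_const 2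
  have e2 := integral_mul_fderiv_eq_neg_fderiv_mul_of_integrable (v := ((1 : ℝ), (0 : ℝ)))
    (hint _ _ hf3 φ.continuous subset_rfl) (hint _ _ hfc2 (hφ1 _) (hφ2 _))
    (hint _ _ hfc2 φ.continuous subset_rfl) (fun z hz => by have := hdiff z hz; fun_prop)
    (fun z _ => hdφ z)
  have e3 := hu.weak φ φ.contDiff φ.hasCompactSupport (hφV.trans hVT)
  have e4 : ∫ z, g z * φ z = 0 := by
    have h1 : ∀ z, g z * φ z =
        fderiv ℝ f z (0, 1) * φ z + fderiv ℝ (fun z => f z ^ 2 / 2) z (1, 0) * φ z := by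
      intro z
      by_cases hz : z ∈ V
      · rw [hsq z hz]; simp only [hg]; ring
      · have : φ z = 0 := image_eq_zero_of_notMem_tsupport fun h => hz (hφV h)
        simp [this]
    simp_rw [h1]
    rw [integral_add (hint _ _ hf1 φ.continuous subset_rfl) (hint _ _ hf3 φ.continuous subset_rfl)]
    rw [integral_add (hint _ _ hfc (hφ1 _) (hφ2 _)) (hint _ _ hfc2 (hφ1 _) (hφ2 _)), e1, e2] at e3
    linarith
  have e5 : ∫ z, g p * (g z * φ z) = 0 := by rw [integral_const_mul, e4, mul_zero]
  obtain ⟨c1, c2⟩ := hcont g φ hgc φ.continuous subset_rfl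
  have := (c1.const_smul (g p)).integral_pos_of_hasCompactSupport_nonneg_nonzero (μ := volume)
    (x := p) c2.smul_left ?_ ?_
  · exact this.ne' e5
  · intro z
    change 0 ≤ g p * (g z * φ z)
    by_cases hz : z ∈ tsupport φ
    · rw [← mul_assoc]
      exact mul_nonneg (hball z (hφs hz)).2.le φ.nonneg
    · simp [image_eq_zero_of_notMem_tsupport hz]
  · change g p * (g p * φ p) ≠ 0
    have : φ p = 1 := φ.one_of_mem_closedBall (by simpa using φ.rIn_pos.le)
    simp [this, hne]

/-! ### The Rankine–Hugoniot condition -/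

/-- Blow-up of the weak formulation at a point `p`: if the rescaled fields `w ↦ u (p + ε w)` are
bounded and converge almost everywhere as `ε → 0`, then the limit is a weak solution as well. -/
theorem IsWeakSolution.integral_blowup_eq_zero {u : ℝ → ℝ → ℝ} {T : ℝ} (hu : IsWeakSolution u T)
    {p : ℝ × ℝ} (hp : p.2 ∈ Ioo 0 T) {ψ : ℝ × ℝ → ℝ} (hψ : ContDiff ℝ (⊤ : ℕ∞) ψ)
    (hψc : HasCompactSupport ψ) {u₀ : ℝ × ℝ → ℝ} {M : ℝ}
    (hbdd : ∀ᶠ ε in 𝓝[>] (0 : ℝ), ∀ᵐ w : ℝ × ℝ, w ∈ tsupport ψ →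
      |u (p + ε • w).1 (p + ε • w).2| ≤ M)
    (hlim : ∀ᵐ w : ℝ × ℝ, Tendsto (fun ε : ℝ => u (p + ε • w).1 (p + ε • w).2) (𝓝[>] 0)
      (𝓝 (u₀ w))) :
    ∫ w : ℝ × ℝ, (u₀ w * fderiv ℝ ψ w (0, 1) + u₀ w ^ 2 / 2 * fderiv ℝ ψ w (1, 0)) = 0 := by
  have hψd : Differentiable ℝ ψ := hψ.differentiable (by simp)
  have hψ1 : ∀ v, Continuous fun z => fderiv ℝ ψ z v := fun v =>
    (hψ.continuous_fderiv (by simp)).clm_apply continuous_const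
  have hψi : ∀ v, Integrable fun z => fderiv ℝ ψ z v := fun v =>
    (hψ1 v).integrable_of_hasCompactSupport (hψc.fderiv_apply ℝ v)
  -- the integrand of the weak formulation for the test function `ψ ((z - p) / ε)`, rescaled
  set F : ℝ → ℝ × ℝ → ℝ := fun ε w => u (p + ε • w).1 (p + ε • w).2 * fderiv ℝ ψ w (0, 1)
    + u (p + ε • w).1 (p + ε • w).2 ^ 2 / 2 * fderiv ℝ ψ w (1, 0) with hF
  have hsupp : ∀ᶠ ε in 𝓝[>] (0 : ℝ), ∀ w ∈ tsupport ψ, (p + ε • w).2 ∈ Ioo 0 T := by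
    have : ∀ᶠ ε in 𝓝 (0 : ℝ), ∀ w ∈ tsupport ψ, (p + ε • w).2 ∈ Ioo 0 T := by
      refine IsCompact.eventually_forall_of_forall_eventually hψc fun w _ => ?_
      have hc : Continuous fun q : ℝ × (ℝ × ℝ) => (p + q.1 • q.2).2 := by fun_prop
      exact hc.continuousAt.eventually (isOpen_Ioo.mem_nhds (by simpa using hp))
    exact this.filter_mono nhdsWithin_le_nhds
  have key : ∀ᶠ ε in 𝓝[>] (0 : ℝ), Integrable (F ε) ∧ ∫ w, F ε w = 0 := by
    filter_upwards [hsupp, self_mem_nhdsWithin] with ε hε hε0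
    have hε0 : 0 < ε := hε0
    set φ : ℝ × ℝ → ℝ := fun z => ψ (ε⁻¹ • (z - p)) with hφ
    have hφd : ContDiff ℝ (⊤ : ℕ∞) φ := hψ.comp (by fun_prop)
    have hemb : IsClosedEmbedding fun z : ℝ × ℝ => ε⁻¹ • (z - p) :=
      ((Homeomorph.subRight p).trans
        (Homeomorph.smulOfNeZero ε⁻¹ (inv_ne_zero hε0.ne'))).isClosedEmbedding
    have hφc : HasCompactSupport φ := hψc.comp_isClosedEmbedding hemb
    have hφs : tsupport φ ⊆ univ ×ˢ Ioo 0 T := by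
      intro z hz
      have h1 := tsupport_comp_subset_preimage ψ hemb.continuous hz
      have h2 := hε _ h1
      rw [smul_inv_smul₀ hε0.ne'] at h2
      simpa using h2
    have hfd : ∀ w v, fderiv ℝ φ (p + ε • w) v = ε⁻¹ * fderiv ℝ ψ w v := by
      intro w v
      have h1 : HasFDerivAt (fun z : ℝ × ℝ => ε⁻¹ • (z - p))
          (ε⁻¹ • ContinuousLinearMap.id ℝ (ℝ × ℝ)) (p + ε • w) :=
        ((hasFDerivAt_id _).sub_const p).const_smul ε⁻¹
      have h0 : ε⁻¹ • (p + ε • w - p) = w := by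
        rw [add_sub_cancel_left, inv_smul_smul₀ hε0.ne']
      have h2 : HasFDerivAt ψ (fderiv ℝ ψ w) (ε⁻¹ • (p + ε • w - p)) := by
        rw [h0]; exact (hψd w).hasFDerivAt
      have h3 := HasFDerivAt.comp (g := ψ) (f := fun z : ℝ × ℝ => ε⁻¹ • (z - p)) (p + ε • w) h2 h1
      have h4 : fderiv ℝ φ (p + ε • w) = _ := h3.fderiv
      rw [h4]
      simp
    set G : ℝ × ℝ → ℝ := fun z => u z.1 z.2 * fderiv ℝ φ z (0, 1)
      + u z.1 z.2 ^ 2 / 2 * fderiv ℝ φ z (1, 0) with hG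
    have hφ1 : ∀ v, Continuous fun z => fderiv ℝ φ z v := fun v =>
      (hφd.continuous_fderiv (by simp)).clm_apply continuous_const
    have hmul : ∀ (h : ℝ × ℝ → ℝ) (v), LocallyIntegrableOn h (univ ×ˢ Ioo 0 T) →
        Integrable fun z => h z * fderiv ℝ φ z v := by
      intro h v hh
      have h1 : IntegrableOn h (tsupport φ) := hh.integrableOn_compact_subset hφs hφc
      have h2 : IntegrableOn (fun z => h z * fderiv ℝ φ z v) (tsupport φ) :=
        h1.mul_continuousOn (hφ1 v).continuousOn hφc
      refine (integrableOn_iff_integrable_of_support_subset ?_).1 h2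
      exact (Function.support_mul_subset_right _ _).trans
        ((subset_tsupport _).trans (tsupport_fderiv_apply_subset ℝ v))
    have hGi : Integrable G := by
      refine (hmul _ _ hu.locallyIntegrable).add ?_
      have := (hmul _ (1, 0) hu.locallyIntegrable_sq).div_const 2
      refine this.congr (ae_of_all _ fun z => ?_)
      simp only; ring
    have hG0 : ∫ z, G z = 0 := hu.weak φ hφd hφc hφs
    have hFG : F ε = fun w => ε * G (p + ε • w) := by
      ext w
      simp only [hF, hG, hfd]
      field_simp
    rw [hFG]
    constructor
    · exact ((hGi.comp_add_left p).comp_smul hε0.ne').const_mul ε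
    · rw [integral_const_mul, Measure.integral_comp_smul volume (fun w => G (p + w)),
        integral_add_left_eq_self, hG0]
      simp
  have hT : Tendsto (fun ε => ∫ w, F ε w) (𝓝[>] 0)
      (𝓝 (∫ w : ℝ × ℝ, (u₀ w * fderiv ℝ ψ w (0, 1) + u₀ w ^ 2 / 2 * fderiv ℝ ψ w (1, 0)))) := by
    refine tendsto_integral_filter_of_dominated_convergence
      (fun w => M * ‖fderiv ℝ ψ w (0, 1)‖ + M ^ 2 / 2 * ‖fderiv ℝ ψ w (1, 0)‖) ?_ ?_ ?_ ?_
    · exact key.mono fun ε h => h.1.aestronglyMeasurable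
    · filter_upwards [hbdd] with ε hε
      filter_upwards [hε] with w hw
      by_cases hws : w ∈ tsupport ψ
      · have h := hw hws
        have h2 : |u (p + ε • w).1 (p + ε • w).2 ^ 2 / 2| ≤ M ^ 2 / 2 := by
          rw [abs_div, abs_pow, abs_two]
          gcongr
        refine (norm_add_le _ _).trans ?_
        rw [norm_mul, norm_mul]
        gcongr <;> assumption
      · have h0 : fderiv ℝ ψ w = 0 := image_eq_zero_of_notMem_tsupport
          fun h => hws (tsupport_fderiv_subset ℝ h)
        simp [hF, h0]
    · exact ((hψi _).norm.const_mul M).add ((hψi _).norm.const_mul _)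
    · filter_upwards [hlim] with w hw
      exact (hw.mul_const _).add (((hw.pow 2).div_const 2).mul_const _)
  exact tendsto_nhds_unique (tendsto_const_nhds.congr' (key.mono fun ε h => h.2.symm)) hT |>.symm

theorem eventually_pos_of_hasDerivAt {h : ℝ → ℝ} {c x : ℝ} (hh : HasDerivAt h c x) (hc : 0 < c)
    (hx : h x = 0) : (∀ᶠ y in 𝓝[>] x, 0 < h y) ∧ ∀ᶠ y in 𝓝[<] x, h y < 0 := by
  have h1 : ∀ᶠ y in 𝓝[≠] x, 0 < slope h x y :=
    (hasDerivAt_iff_tendsto_slope.1 hh).eventually (lt_mem_nhds hc)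
  constructor
  · filter_upwards [h1.filter_mono (nhdsGT_le_nhdsNE x), self_mem_nhdsWithin] with y hy hxy
    have hxy : x < y := hxy
    rw [slope_def_field, hx, sub_zero] at hy
    exact (div_pos_iff_of_pos_right (sub_pos.2 hxy)).1 hy
  · filter_upwards [h1.filter_mono (nhdsLT_le_nhdsNE x), self_mem_nhdsWithin] with y hy hxy
    have hxy : y < x := hxy
    rw [slope_def_field, hx, sub_zero] at hy
    by_contra! hcon
    exact absurd hy (not_lt.2 (div_nonpos_of_nonneg_of_nonpos hcon (sub_neg.2 hxy).le))

theorem ae_fst_ne_of_continuous {g : ℝ → ℝ} (hg : Continuous g) :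
    ∀ᵐ w : ℝ × ℝ, w.1 ≠ g w.2 := by
  have hcl : IsClosed {w : ℝ × ℝ | w.1 = g w.2} :=
    isClosed_eq continuous_fst (hg.comp continuous_snd)
  rw [ae_iff]
  simp only [not_not]
  rw [Measure.volume_eq_prod, Measure.prod_apply_symm hcl.measurableSet]
  simp

theorem ae_fst_ne_of_continuous_comp {g : ℝ → ℝ} (hg : Continuous g) (p : ℝ × ℝ) {ε : ℝ}
    (hε : ε ≠ 0) : ∀ᵐ w : ℝ × ℝ, (p + ε • w).1 ≠ g (p + ε • w).2 := by
  have := ae_fst_ne_of_continuous (g := fun s => ε⁻¹ * (g (p.2 + ε * s) - p.1)) (by fun_prop)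
  filter_upwards [this] with w hw hcon
  apply hw
  simp only [Prod.fst_add, Prod.snd_add, Prod.smul_fst, Prod.smul_snd, smul_eq_mul] at hcon
  rw [← hcon]
  field_simp
  ring

/-- The distributional derivative of a step function. -/
theorem integral_step_mul_deriv {f : ℝ → ℝ} (hf : ContDiff ℝ 1 f) (hfc : HasCompactSupport f)
    (a b : ℝ) : ∫ x, (if 0 < x then a else b) * deriv f x = (b - a) * f 0 := by
  have hi : Integrable (deriv f) :=
    (hf.continuous_deriv le_rfl).integrable_of_hasCompactSupport hfc.deriv
  have hm : Measurable fun x : ℝ => if 0 < x then a else b :=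
    Measurable.ite measurableSet_Ioi measurable_const measurable_const
  have hI : Integrable fun x => (if 0 < x then a else b) * deriv f x := by
    refine hi.bdd_mul (c := max |a| |b|) hm.aestronglyMeasurable (ae_of_all _ fun x => ?_)
    split_ifs <;> simp
  rw [← integral_add_compl (measurableSet_Ioi (a := (0 : ℝ))) hI, compl_Ioi]
  rw [setIntegral_congr_fun (g := fun x => a * deriv f x) measurableSet_Ioi
    (fun x hx => by simp [mem_Ioi.1 hx]),
    setIntegral_congr_fun (g := fun x => b * deriv f x) measurableSet_Iic
    (fun x hx => by simp [not_lt.2 (mem_Iic.1 hx)]), integral_const_mul, integral_const_mul,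
    hfc.integral_Ioi_deriv_eq hf, hfc.integral_Iic_deriv_eq hf]
  ring

/-- A step function that travels at speed `m` is a weak solution only if `m` is the average of its
two values. It suffices to test with a product of bumps in the moving frame. -/
theorem eq_average_of_step_weak_solution {m a b : ℝ} (hab : a ≠ b)
    (h : ∀ ψ : ℝ × ℝ → ℝ, ContDiff ℝ (⊤ : ℕ∞) ψ → HasCompactSupport ψ →
      ∫ w : ℝ × ℝ, ((if 0 < w.1 - m * w.2 then a else b) * fderiv ℝ ψ w (0, 1)
        + (if 0 < w.1 - m * w.2 then a else b) ^ 2 / 2 * fderiv ℝ ψ w (1, 0)) = 0) :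
    m = (b + a) / 2 := by
  let f : ContDiffBump (0 : ℝ) := ⟨1, 2, one_pos, one_lt_two⟩
  have hf : ContDiff ℝ 1 f := f.contDiff
  have hfd : Differentiable ℝ f := hf.differentiable one_ne_zero
  have hfc : HasCompactSupport f := f.hasCompactSupport
  have hi : Integrable f := f.continuous.integrable_of_hasCompactSupport hfc
  have hi' : Integrable (deriv f) :=
    (hf.continuous_deriv le_rfl).integrable_of_hasCompactSupport hfc.deriv
  set U : ℝ → ℝ := fun x => if 0 < x then a else b with hU
  have hUm : Measurable U :=
    Measurable.ite measurableSet_Ioi measurable_const measurable_const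
  have hUb : ∀ x, ‖U x‖ ≤ max |a| |b| := by
    intro x; simp only [hU]; split_ifs <;> simp
  set ψ : ℝ × ℝ → ℝ := fun w => f (w.1 - m * w.2) * f w.2 with hψ
  have hψd : ContDiff ℝ (⊤ : ℕ∞) ψ := by
    have h1 : ContDiff ℝ (⊤ : ℕ∞) f := f.contDiff
    exact (h1.comp (by fun_prop)).mul (h1.comp (by fun_prop))
  have hψc : HasCompactSupport ψ := by
    refine HasCompactSupport.intro
      (K := (fun q : ℝ × ℝ => (q.1 + m * q.2, q.2)) '' (tsupport f ×ˢ tsupport f)) ?_ ?_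
    · exact (IsCompact.prod hfc hfc).image (by fun_prop)
    · intro w hw
      by_contra hne
      apply hw
      refine ⟨(w.1 - m * w.2, w.2), ⟨subset_tsupport _ ?_, subset_tsupport _ ?_⟩, by simp⟩
      · exact left_ne_zero_of_mul hne
      · exact right_ne_zero_of_mul hne
  have hfder : ∀ w : ℝ × ℝ, HasFDerivAt ψ
      (f (w.1 - m * w.2) • (deriv f w.2 • ContinuousLinearMap.snd ℝ ℝ ℝ)
        + f w.2 • (deriv f (w.1 - m * w.2) • (ContinuousLinearMap.fst ℝ ℝ ℝ
          - m • ContinuousLinearMap.snd ℝ ℝ ℝ))) w := by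
    intro w
    have h0 : HasFDerivAt (fun w : ℝ × ℝ => w.2) (ContinuousLinearMap.snd ℝ ℝ ℝ) w :=
      hasFDerivAt_snd
    have h1 : HasFDerivAt (fun w : ℝ × ℝ => w.1 - m * w.2) (ContinuousLinearMap.fst ℝ ℝ ℝ
          - m • ContinuousLinearMap.snd ℝ ℝ ℝ) w :=
      hasFDerivAt_fst.sub (h0.const_mul m)
    have h2 := (hfd (w.1 - m * w.2)).hasDerivAt.comp_hasFDerivAt w h1
    have h3 := (hfd w.2).hasDerivAt.comp_hasFDerivAt w h0
    exact h2.mul h3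
  have e1 : ∀ w, fderiv ℝ ψ w (0, 1) =
      f (w.1 - m * w.2) * deriv f w.2 - m * (f w.2 * deriv f (w.1 - m * w.2)) := by
    intro w
    rw [(hfder w).fderiv]
    simp
    ring
  have e2 : ∀ w, fderiv ℝ ψ w (1, 0) = f w.2 * deriv f (w.1 - m * w.2) := by
    intro w
    rw [(hfder w).fderiv]
    simp
  have key := h ψ hψd hψc
  have hψ1 : ∀ v, Integrable fun z => fderiv ℝ ψ z v := fun v =>
    ((hψd.continuous_fderiv (by simp)).clm_apply
      continuous_const).integrable_of_hasCompactSupport (hψc.fderiv_apply ℝ v)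
  have hUm2 : Measurable fun w : ℝ × ℝ => U (w.1 - m * w.2) := hUm.comp (by fun_prop)
  have hI : Integrable fun w : ℝ × ℝ => (U (w.1 - m * w.2) * fderiv ℝ ψ w (0, 1)
        + U (w.1 - m * w.2) ^ 2 / 2 * fderiv ℝ ψ w (1, 0)) := by
    refine ((hψ1 _).bdd_mul (c := max |a| |b|) hUm2.aestronglyMeasurable
      (ae_of_all _ fun x => hUb _)).add
      ((hψ1 _).bdd_mul (c := max |a| |b| ^ 2 / 2)
        ((hUm2.pow_const 2).div_const 2).aestronglyMeasurable
        (ae_of_all _ fun x => ?_))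
    rw [norm_div, norm_pow, Real.norm_two]
    gcongr
    exact hUb _
  set c : ℝ → ℝ := fun x => if 0 < x then -m * a + a ^ 2 / 2 else -m * b + b ^ 2 / 2 with hc
  have hcm : Measurable c :=
    Measurable.ite measurableSet_Ioi measurable_const measurable_const
  have hcU : ∀ x, c x = -m * U x + U x ^ 2 / 2 := by
    intro x; simp only [hc, hU]; split_ifs <;> rfl
  have hci : Integrable fun x => c x * deriv f x := by
    refine hi'.bdd_mul (c := max |-m * a + a ^ 2 / 2| |-m * b + b ^ 2 / 2|)
      hcm.aestronglyMeasurable (ae_of_all _ fun x => ?_)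
    simp only [hc]; split_ifs <;> simp
  have hUi : Integrable fun x => U x * f x :=
    hi.bdd_mul hUm.aestronglyMeasurable (ae_of_all _ hUb)
  -- the inner integral in the moving frame; the second term drops out after integration in `s`
  have hinner : ∀ s, ∫ x, (U (x - m * s) * fderiv ℝ ψ (x, s) (0, 1)
        + U (x - m * s) ^ 2 / 2 * fderiv ℝ ψ (x, s) (1, 0)) =
      (∫ x, c x * deriv f x) * f s + (∫ x, U x * f x) * deriv f s := by
    intro s
    have h1 : ∀ x, U (x - m * s) * fderiv ℝ ψ (x, s) (0, 1)
        + U (x - m * s) ^ 2 / 2 * fderiv ℝ ψ (x, s) (1, 0) =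
        (fun y => c y * deriv f y * f s + U y * f y * deriv f s) (x - m * s) := by
      intro x
      rw [e1, e2]
      simp only [hcU]
      ring
    simp_rw [h1]
    rw [integral_sub_right_eq_self (fun y => c y * deriv f y * f s + U y * f y * deriv f s) (m * s),
      integral_add (hci.mul_const _) (hUi.mul_const _), integral_mul_const, integral_mul_const]
  rw [Measure.volume_eq_prod] at key hI
  rw [integral_prod_symm _ hI] at key
  simp_rw [hinner] at key
  have hder0 : ∫ s, deriv f s = 0 :=
    integral_eq_zero_of_hasDerivAt_of_integrable (fun x => (hfd x).hasDerivAt) hi' hi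
  rw [integral_add (hi.const_mul _) (hi'.const_mul _), integral_const_mul, integral_const_mul,
    hder0, mul_zero, add_zero, integral_step_mul_deriv hf hfc] at key
  have hf0 : f 0 = 1 := f.one_of_mem_closedBall (by simp [f.rIn_pos.le])
  have hpos : 0 < ∫ s, f s := f.integral_pos
  rw [hf0, mul_one] at key
  have h5 := (mul_eq_zero.1 key).resolve_right hpos.ne'
  have h6 : (b - a) * ((b + a) / 2 - m) = 0 := by linear_combination h5
  have h7 := (mul_eq_zero.1 h6).resolve_left (sub_ne_zero.2 hab.symm)
  linarith

/-- The Rankine–Hugoniot condition, pointwise: a curve that separates two distinct one-sided limits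
of a weak solution moves at their average velocity. No regularity of the field off the curve is
needed. -/
theorem IsWeakSolution.rankine_hugoniot {u : ℝ → ℝ → ℝ} {T : ℝ} (hu : IsWeakSolution u T)
    {xs : ℝ → ℝ} {τ m a b : ℝ} (hτ : τ ∈ Ioo 0 T) (hm : HasDerivAt xs m τ)
    (hxs : ∀ᶠ t in 𝓝 τ, ContinuousAt xs t)
    (ha : Tendsto (fun z : ℝ × ℝ => u z.1 z.2) (𝓝[{z | xs z.2 < z.1}] (xs τ, τ)) (𝓝 a))
    (hb : Tendsto (fun z : ℝ × ℝ => u z.1 z.2) (𝓝[{z | z.1 < xs z.2}] (xs τ, τ)) (𝓝 b))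
    (hab : a ≠ b) : m = (b + a) / 2 := by
  set p : ℝ × ℝ := (xs τ, τ) with hp
  -- a continuous function on the line that coincides with the curve near `τ`
  obtain ⟨g, hg, hgx⟩ : ∃ g : ℝ → ℝ, Continuous g ∧ ∀ᶠ t in 𝓝 τ, g t = xs t := by
    obtain ⟨δ, hδ, hball⟩ := Metric.eventually_nhds_iff_ball.1 hxs
    have hle : τ - δ / 2 ≤ τ + δ / 2 := by linarith
    refine ⟨IccExtend hle ((Icc (τ - δ / 2) (τ + δ / 2)).domRestrict xs), ?_, ?_⟩
    · refine Continuous.Icc_extend' (ContinuousOn.domRestrict fun t ht => ?_)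
      refine (hball t ?_).continuousWithinAt
      rw [Real.ball_eq_Ioo]
      exact ⟨by linarith [ht.1], by linarith [ht.2]⟩
    · filter_upwards [Icc_mem_nhds (show τ - δ / 2 < τ by linarith)
        (show τ < τ + δ / 2 by linarith)] with t ht
      rw [IccExtend_of_mem _ _ ht]
      rfl
  refine eq_average_of_step_weak_solution hab fun ψ hψ hψc => ?_
  have hnear : ∀ q : ℝ × ℝ → Prop, (∀ᶠ z in 𝓝 p, q z) →
      ∀ᶠ ε in 𝓝[>] (0 : ℝ), ∀ w ∈ tsupport ψ, q (p + ε • w) := by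
    intro q hq
    have : ∀ᶠ ε in 𝓝 (0 : ℝ), ∀ w ∈ tsupport ψ, q (p + ε • w) := by
      refine IsCompact.eventually_forall_of_forall_eventually hψc fun w _ => ?_
      have hc : Continuous fun r : ℝ × (ℝ × ℝ) => p + r.1 • r.2 := by fun_prop
      have : Tendsto (fun r : ℝ × (ℝ × ℝ) => p + r.1 • r.2) (𝓝 (0, w)) (𝓝 p) := by
        simpa using hc.tendsto (0, w)
      exact this.eventually hq
    exact this.filter_mono nhdsWithin_le_nhds
  have hbd : ∀ᶠ z in 𝓝 p, z.1 ≠ g z.2 → |u z.1 z.2| ≤ max (|a| + 1) (|b| + 1) := by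
    have ha' := eventually_nhdsWithin_iff.1
      (ha.abs.eventually (ge_mem_nhds (lt_add_one |a|)))
    have hb' := eventually_nhdsWithin_iff.1
      (hb.abs.eventually (ge_mem_nhds (lt_add_one |b|)))
    have hg' : ∀ᶠ z : ℝ × ℝ in 𝓝 p, g z.2 = xs z.2 :=
      (continuous_snd.tendsto p).eventually hgx
    filter_upwards [ha', hb', hg'] with z h1 h2 h3 hne
    rw [h3] at hne
    rcases lt_or_gt_of_ne hne with h | h
    · exact (h2 h).trans (le_max_right _ _)
    · exact (h1 h).trans (le_max_left _ _)
  refine hu.integral_blowup_eq_zero (p := p) hτ hψ hψc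
    (u₀ := fun w => if 0 < w.1 - m * w.2 then a else b) (M := max (|a| + 1) (|b| + 1)) ?_ ?_
  · filter_upwards [hnear _ hbd, self_mem_nhdsWithin] with ε hε hε0
    filter_upwards [ae_fst_ne_of_continuous_comp hg p (ne_of_gt hε0)] with w hw hws
    exact hε w hws hw
  · filter_upwards [ae_fst_ne_of_continuous (g := fun s => m * s) (by fun_prop)] with w hw
    have hline : Tendsto (fun ε : ℝ => p + ε • w) (𝓝[>] 0) (𝓝 p) := by
      have : Continuous fun ε : ℝ => p + ε • w := by fun_prop
      simpa using (this.tendsto 0).mono_left nhdsWithin_le_nhds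
    have hder : HasDerivAt (fun ε : ℝ => xs τ + ε * w.1 - xs (τ + ε * w.2)) (w.1 - m * w.2) 0 := by
      have h1 : HasDerivAt (fun ε : ℝ => τ + ε * w.2) w.2 0 := by
        simpa using ((hasDerivAt_id (0 : ℝ)).mul_const w.2).const_add τ
      have h2 : HasDerivAt (fun ε : ℝ => xs τ + ε * w.1) w.1 0 := by
        simpa using ((hasDerivAt_id (0 : ℝ)).mul_const w.1).const_add (xs τ)
      have h3 : HasDerivAt xs m (τ + 0 * w.2) := by simpa using hm
      exact h2.sub (h3.comp (0 : ℝ) h1)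
    rcases lt_or_gt_of_ne hw with h | h
    · have h0 : ¬ 0 < w.1 - m * w.2 := by linarith
      simp only [h0, if_false]
      refine hb.comp (tendsto_nhdsWithin_iff.2 ⟨hline, ?_⟩)
      have := (eventually_pos_of_hasDerivAt hder.neg (by linarith) (by simp)).1
      filter_upwards [this] with ε hε
      simp at hε ⊢
      simpa [p] using hε
    · have h0 : 0 < w.1 - m * w.2 := by linarith
      simp only [h0, if_true]
      refine ha.comp (tendsto_nhdsWithin_iff.2 ⟨hline, ?_⟩)
      have := (eventually_pos_of_hasDerivAt hder (by linarith) (by simp)).1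
      filter_upwards [this] with ε hε
      simp at hε ⊢
      simpa [p] using hε

/-! ### Auxiliary results of analysis -/

/-- One-sided limits of a function depend continuously on the point of approach: if `f` has the
limit `y` at `x` within `A`, and `g i` at `γ i` within `A`, then `g` tends to `y` as `γ`
tends to `x`. -/
theorem tendsto_of_tendsto_nhdsWithin {X Y ι : Type*} [TopologicalSpace X] [TopologicalSpace Y]
    [RegularSpace Y] {l : Filter ι} {f : X → Y} {A : Set X} {γ : ι → X} {g : ι → Y} {x : X} {y : Y}
    (hf : Tendsto f (𝓝[A] x) (𝓝 y)) (hγ : Tendsto γ l (𝓝 x))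
    (h : ∀ᶠ i in l, (𝓝[A] γ i).NeBot ∧ Tendsto f (𝓝[A] γ i) (𝓝 (g i))) :
    Tendsto g l (𝓝 y) := by
  refine (closed_nhds_basis y).tendsto_right_iff.2 fun N ⟨hN, hNc⟩ => ?_
  have h1 : ∀ᶠ z in 𝓝 x, ∀ᶠ w in 𝓝 z, w ∈ A → f w ∈ N :=
    (eventually_nhdsWithin_iff.1 (hf.eventually hN)).eventually_nhds
  filter_upwards [hγ.eventually h1, h] with i hi hi'
  obtain ⟨hne, hi'⟩ := hi'
  exact hNc.mem_of_tendsto hi' (eventually_nhdsWithin_iff.2 hi)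

/-- Uniqueness for the linear equation `w' = c w` on an open interval, with a zero terminal value
attained as a limit. -/
theorem eq_zero_of_hasDerivAt_mul_of_tendsto_zero {w c : ℝ → ℝ} {a b k : ℝ}
    (hw : ∀ t ∈ Ioo a b, HasDerivAt w (c t * w t) t) (hc : ContinuousOn c (Ioo a b))
    (hck : Tendsto c (𝓝[<] b) (𝓝 k)) (hwb : Tendsto w (𝓝[<] b) (𝓝 0)) :
    ∀ t ∈ Ioo a b, w t = 0 := by
  intro t ht
  obtain ⟨r, har, hrt⟩ := exists_between ht.1
  have hrb : r < b := hrt.trans ht.2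
  obtain ⟨K, hK⟩ : ∃ K, ∀ s ∈ Ioo r b, |c s| ≤ K := by
    have hce := continuousOn_Icc_extendFrom_Ioo (hc.mono (Ioo_subset_Ioo_left har.le))
      ((hc.continuousAt (Ioo_mem_nhds har hrb)).mono_left nhdsWithin_le_nhds) hck
    obtain ⟨K, hK⟩ := isCompact_Icc.exists_bound_of_continuousOn hce
    refine ⟨K, fun s hs => ?_⟩
    have := hK s (Ioo_subset_Icc_self hs)
    rwa [extendFrom_eq (by rw [closure_Ioo hrb.ne]; exact Ioo_subset_Icc_self hs)
      ((hc.continuousAt (Ioo_mem_nhds (har.trans hs.1) hs.2)).mono_left nhdsWithin_le_nhds)] at this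
  -- Grönwall's inequality for the reversed function, from `s` back to `t`
  have hbound : ∀ s ∈ Ioo t b, |w t| ≤ |w s| * Real.exp (K * (s - t)) := by
    intro s hs
    have hmem : ∀ x ∈ Icc (-s) (-t), -x ∈ Ioo r b := fun x hx =>
      ⟨by linarith [hx.2], by linarith [hx.1, hs.2]⟩
    have hd : ∀ x ∈ Icc (-s) (-t), HasDerivAt (fun x => w (-x)) (-(c (-x) * w (-x))) x := by
      intro x hx
      have h := (hw (-x) ⟨har.trans (hmem x hx).1, (hmem x hx).2⟩).comp x (hasDerivAt_neg x)
      exact h.congr_deriv (by ring)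
    have := norm_le_gronwallBound_of_norm_deriv_right_le (f := fun x => w (-x))
      (δ := |w s|) (K := K) (ε := 0)
      (fun x hx => (hd x hx).continuousAt.continuousWithinAt)
      (fun x hx => (hd x (Ico_subset_Icc_self hx)).hasDerivWithinAt) (by simp)
      (fun x hx => by
        rw [norm_neg, norm_mul, add_zero]
        exact mul_le_mul_of_nonneg_right (hK _ (hmem x (Ico_subset_Icc_self hx))) (norm_nonneg _))
      (-t) (right_mem_Icc.2 (by linarith [hs.1]))
    rw [gronwallBound_ε0] at this
    simpa [add_comm, sub_eq_add_neg] using this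
  have hlim : Tendsto (fun s => |w s| * Real.exp (K * (s - t))) (𝓝[<] b)
      (𝓝 (|0| * Real.exp (K * (b - t)))) := by
    refine hwb.abs.mul (Tendsto.mono_left (Continuous.tendsto ?_ b) nhdsWithin_le_nhds)
    fun_prop
  have : |w t| ≤ |0| * Real.exp (K * (b - t)) :=
    ge_of_tendsto hlim ((Ioo_mem_nhdsLT ht.2 : Ioo t b ∈ 𝓝[<] b) |> fun h =>
      mem_of_superset h hbound)
  simpa using this

/-- Backward induction on a real interval. -/
theorem forall_mem_Ioo_of_backward {P : ℝ → Prop} {r b : ℝ} (hb : ∀ᶠ t in 𝓝[<] b, P t)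
    (hopen : ∀ t ∈ Ioo r b, P t → ∀ᶠ s in 𝓝[<] t, P s)
    (hstep : ∀ t ∈ Ioo r b, (∀ s ∈ Ioo t b, P s) → P t) : ∀ t ∈ Ioo r b, P t := by
  by_contra! hcon
  obtain ⟨t, ht, hPt⟩ := hcon
  set S : Set ℝ := {t | t ∈ Ioo r b ∧ ¬ P t} with hS
  have hne : S.Nonempty := ⟨t, ht, hPt⟩
  have hbdd : BddAbove S := ⟨b, fun s hs => hs.1.2.le⟩
  have hsup : ∀ c, (∀ᶠ t in 𝓝[<] c, P t) → (∀ s ∈ S, s < c) → sSup S < c := by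
    intro c hc hSc
    obtain ⟨l, hl, hlP⟩ := (mem_nhdsLT_iff_exists_Ioo_subset).1 hc
    refine (csSup_le hne fun s hs => ?_).trans_lt hl
    by_contra! h
    exact hs.2 (hlP ⟨h, hSc s hs⟩)
  have h1 : sSup S < b := hsup b hb fun s hs => hs.1.2
  have h2 : sSup S ∈ Ioo r b := ⟨ht.1.trans_le (le_csSup hbdd ⟨ht, hPt⟩), h1⟩
  have h3 : P (sSup S) := hstep _ h2 fun s hs => by
    by_contra h
    exact not_le.2 hs.1 (le_csSup hbdd ⟨⟨h2.1.trans hs.1, hs.2⟩, h⟩)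
  refine lt_irrefl _ (hsup _ (hopen _ h2 h3) fun s hs => ?_)
  refine (le_csSup hbdd hs).lt_of_ne fun h => hs.2 (h ▸ h3)

theorem nonneg_of_hasDerivAt_of_forall_le {f : ℝ → ℝ} {f' a x : ℝ} (hf : HasDerivAt f f' x)
    (hax : a < x) (h : ∀ y ∈ Ioo a x, f y ≤ f x) : 0 ≤ f' := by
  refine ge_of_tendsto ((hasDerivAt_iff_tendsto_slope.1 hf).mono_left (nhdsLT_le_nhdsNE x)) ?_
  filter_upwards [Ioo_mem_nhdsLT hax] with y hy
  rw [slope_def_field]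
  exact div_nonneg_of_nonpos (sub_nonpos.2 (h y hy)) (sub_nonpos.2 hy.2.le)

theorem uBar_eq_of_continuousAt {u : ℝ → ℝ → ℝ} {x t : ℝ}
    (h : ContinuousAt (fun y => u y t) x) : uBar u x t = u x t := by
  rw [uBar, rightLim_eq_of_tendsto (h.mono_left nhdsWithin_le_nhds),
    leftLim_eq_of_tendsto (h.mono_left nhdsWithin_le_nhds), add_self_div_two]

/-! ### Setting and notation -/

/-- The sign of a side of the shock: `1` on the right (`true`) and `-1` on the left (`false`). -/
def side : Bool → ℝ
  | true => 1
  | false => -1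

/-- The straight characteristic that enters the shock at time `τ` from the side `σ`, as a function
of time. -/
noncomputable def charLine (u : ℝ → ℝ → ℝ) (xs : ℝ → ℝ) (σ : Bool) (τ t : ℝ) : ℝ :=
  xs τ + sideVel u xs σ τ * (t - τ)

/-- The part of `U` at times in `(0, T)` off the shock and its formation point, where a regular
field is `C¹`. -/
def smoothRegion (xs : ℝ → ℝ) (ts T : ℝ) (U : Set (ℝ × ℝ)) : Set (ℝ × ℝ) :=
  (U ∩ {z | z.2 ∈ Ioo 0 T}) \ (shockSet xs ts T ∪ {(xs ts, ts)})

/-- A weak solution with a single shock, together with a neighbourhood `U` of the shock triangle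
that witnesses the regularity condition of `IsSingleShock`. -/
structure ShockSetup (u : ℝ → ℝ → ℝ) (xs : ℝ → ℝ) (ts tf T : ℝ) (U : Set (ℝ × ℝ)) : Prop where
  ts_pos : 0 < ts
  ts_lt_tf : ts < tf
  tf_lt : tf < T
  weak : IsWeakSolution u T
  shock : IsSingleShock u xs ts tf T
  isOpen : IsOpen U
  triangle_subset : shockTriangle u xs tf ⊆ U
  continuousOn : ContinuousOn (fun z : ℝ × ℝ => u z.1 z.2)
    ((U ∩ {z | z.2 ∈ Ico 0 T}) \ shockSet xs ts T)
  contDiffOn : ContDiffOn ℝ 1 (fun z : ℝ × ℝ => u z.1 z.2) (smoothRegion xs ts T U)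

variable {u : ℝ → ℝ → ℝ} {xs : ℝ → ℝ} {ts tf T : ℝ} {U : Set (ℝ × ℝ)} {σ : Bool} {τ t : ℝ}

theorem side_mul_side (σ : Bool) : side σ * side σ = 1 := by cases σ <;> norm_num [side]

theorem charLine_self : charLine u xs σ τ τ = xs τ := by simp [charLine]

theorem hasDerivAt_charLine : HasDerivAt (charLine u xs σ τ) (sideVel u xs σ τ) t := by
  have h := (((hasDerivAt_id t).sub_const τ).const_mul (sideVel u xs σ τ)).const_add (xs τ)
  exact h.congr_deriv (mul_one _)

theorem continuous_charLine : Continuous (charLine u xs σ τ) :=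
  continuous_iff_continuousAt.2 fun _ => hasDerivAt_charLine.continuousAt

theorem mem_sideSet {z : ℝ × ℝ} :
    z ∈ sideSet xs ts T σ ↔ z.2 ∈ Ioo ts T ∧ 0 < side σ * (z.1 - xs z.2) := by
  cases σ <;> simp [sideSet, side]

theorem mem_shockTriangle {z : ℝ × ℝ} :
    z ∈ shockTriangle u xs tf ↔
      z.2 ∈ Icc 0 tf ∧ ∀ σ, 0 ≤ side σ * (charLine u xs σ tf z.2 - z.1) := by
  simp [shockTriangle, side, charLine]

theorem isClosed_shockTriangle : IsClosed (shockTriangle u xs tf) := by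
  have : shockTriangle u xs tf = {z | z.2 ∈ Icc 0 tf} ∩
      ⋂ σ, {z : ℝ × ℝ | 0 ≤ side σ * (charLine u xs σ tf z.2 - z.1)} := by
    ext z
    simp only [mem_shockTriangle, mem_inter_iff, mem_iInter, mem_ofPred_eq]
  rw [this]
  refine (isClosed_Icc.preimage continuous_snd).inter (isClosed_iInter fun σ => ?_)
  have := (continuous_charLine (u := u) (xs := xs) (σ := σ) (τ := tf)).comp
    (continuous_snd (X := ℝ) (Y := ℝ))
  exact isClosed_le continuous_const (continuous_const.mul (this.sub continuous_fst))

namespace ShockSetup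

/-! ### The shock curve and the traces of the field -/

theorem continuousWithinAt_curve (H : ShockSetup u xs ts tf T U) (hτ : τ ∈ Ico ts T) :
    ContinuousWithinAt xs (Ici τ) τ :=
  (H.shock.continuousOn_curve τ hτ).mono_of_mem_nhdsWithin
    (mem_of_superset (Ico_mem_nhdsGE hτ.2) (Ico_subset_Ico_left hτ.1))

theorem continuousAt_curve (H : ShockSetup u xs ts tf T U) (hτ : τ ∈ Ioo ts T) :
    ContinuousAt xs τ :=
  H.shock.continuousOn_curve.continuousAt (Ico_mem_nhds hτ.1 hτ.2)

theorem nhdsWithin_sideSet (hτ : τ ∈ Ioo ts T) :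
    𝓝[sideSet xs ts T σ] (xs τ, τ) = 𝓝[{z | 0 < side σ * (z.1 - xs z.2)}] (xs τ, τ) := by
  have h : {z : ℝ × ℝ | z.2 ∈ Ioo ts T} ∈ 𝓝 (xs τ, τ) :=
    continuous_snd.continuousAt.preimage_mem_nhds (Ioo_mem_nhds hτ.1 hτ.2)
  have h2 : sideSet xs ts T σ =
      {z | 0 < side σ * (z.1 - xs z.2)} ∩ {z : ℝ × ℝ | z.2 ∈ Ioo ts T} := by
    ext z
    rw [mem_sideSet, and_comm]
    rfl
  rw [h2, nhdsWithin_inter_of_mem' (mem_nhdsWithin_of_mem_nhds h)]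

/-- The Rankine–Hugoniot condition along the shock. -/
theorem hasDerivAt_curve (H : ShockSetup u xs ts tf T U) (hτ : τ ∈ Ioo ts T) :
    HasDerivAt xs (shockVel u xs τ) τ := by
  have hd : DifferentiableAt ℝ xs τ :=
    (H.shock.contDiffOn_curve.differentiableOn one_ne_zero).differentiableAt
      (Ioo_mem_nhds hτ.1 hτ.2)
  have hr := H.shock.tendsto_vel true τ hτ
  have hl := H.shock.tendsto_vel false τ hτ
  rw [nhdsWithin_sideSet hτ] at hr hl
  have := H.weak.rankine_hugoniot ⟨H.ts_pos.trans hτ.1, hτ.2⟩ hd.hasDerivAt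
    (by filter_upwards [Ioo_mem_nhds hτ.1 hτ.2] with t ht using H.continuousAt_curve ht)
    (by simpa [side] using hr) (by simpa [side] using hl) (H.shock.admissible τ hτ).ne
  exact hd.hasDerivAt.congr_deriv this

theorem shockVel_sub_sideVel (u : ℝ → ℝ → ℝ) (xs : ℝ → ℝ) (σ : Bool) (τ : ℝ) :
    shockVel u xs τ - sideVel u xs σ τ =
      side σ * ((sideVel u xs false τ - sideVel u xs true τ) / 2) := by
  cases σ <;> simp only [shockVel, side] <;> ring

/-- Characteristics enter the shock from both sides. -/
theorem side_mul_shockVel_sub_pos (H : ShockSetup u xs ts tf T U) (hτ : τ ∈ Ioo ts T) :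
    0 < side σ * (shockVel u xs τ - sideVel u xs σ τ) := by
  rw [shockVel_sub_sideVel, ← mul_assoc, side_mul_side, one_mul]
  linarith [H.shock.admissible τ hτ]

theorem nhdsWithin_sideSet_neBot (H : ShockSetup u xs ts tf T U) (hτ : τ ∈ Ico ts T) :
    (𝓝[sideSet xs ts T σ] (xs τ, τ)).NeBot := by
  have h : Tendsto (fun t => (xs t + side σ * (t - τ), t)) (𝓝[>] τ)
      (𝓝[sideSet xs ts T σ] (xs τ, τ)) := by
    refine tendsto_nhdsWithin_iff.2 ⟨Tendsto.prodMk_nhds ?_ nhdsWithin_le_nhds, ?_⟩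
    · have h1 : Tendsto xs (𝓝[>] τ) (𝓝 (xs τ)) :=
        (H.continuousWithinAt_curve hτ).mono Ioi_subset_Ici_self
      have h2 : Tendsto (fun t => side σ * (t - τ)) (𝓝[>] τ) (𝓝 (side σ * (τ - τ))) :=
        (Continuous.tendsto (by fun_prop) τ).mono_left nhdsWithin_le_nhds
      simpa using h1.add h2
    · filter_upwards [Ioo_mem_nhdsGT hτ.2] with t ht
      refine mem_sideSet.2 ⟨⟨hτ.1.trans_lt ht.1, ht.2⟩, ?_⟩
      rw [add_sub_cancel_left, ← mul_assoc, side_mul_side, one_mul]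
      exact sub_pos.2 ht.1
  exact h.neBot

theorem tendsto_sideVel_of_tendsto (H : ShockSetup u xs ts tf T U) {a : ℝ} (hτ : τ ∈ Ico ts T)
    (h : Tendsto (fun z : ℝ × ℝ => u z.1 z.2) (𝓝[sideSet xs ts T σ] (xs τ, τ)) (𝓝 a)) :
    Tendsto (sideVel u xs σ) (𝓝[>] τ) (𝓝 a) := by
  refine tendsto_of_tendsto_nhdsWithin (γ := fun t => (xs t, t)) h ?_ ?_
  · exact Tendsto.prodMk_nhds ((H.continuousWithinAt_curve hτ).mono Ioi_subset_Ici_self)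
      nhdsWithin_le_nhds
  · filter_upwards [Ioo_mem_nhdsGT hτ.2] with t ht
    exact ⟨H.nhdsWithin_sideSet_neBot ⟨hτ.1.trans ht.1.le, ht.2⟩,
      H.shock.tendsto_vel σ t ⟨hτ.1.trans_lt ht.1, ht.2⟩⟩

/-- One-sided limits along the shock, of whatever function, depend continuously on time. -/
theorem continuousAt_trace (H : ShockSetup u xs ts tf T U) (hτ : τ ∈ Ioo ts T) {f : ℝ × ℝ → ℝ}
    {g : ℝ → ℝ}
    (h : ∀ t ∈ Ioo ts T, Tendsto f (𝓝[sideSet xs ts T σ] (xs t, t)) (𝓝 (g t))) :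
    ContinuousAt g τ := by
  refine tendsto_of_tendsto_nhdsWithin (γ := fun t => (xs t, t)) (h τ hτ) ?_ ?_
  · exact Tendsto.prodMk_nhds (H.continuousAt_curve hτ) tendsto_id
  · filter_upwards [Ioo_mem_nhds hτ.1 hτ.2] with t ht
    exact ⟨H.nhdsWithin_sideSet_neBot (Ioo_subset_Ico_self ht), h t ht⟩

theorem continuousAt_sideVel (H : ShockSetup u xs ts tf T U) (hτ : τ ∈ Ioo ts T) :
    ContinuousAt (sideVel u xs σ) τ :=
  H.continuousAt_trace hτ (H.shock.tendsto_vel σ)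

theorem continuousAt_sideGrad (H : ShockSetup u xs ts tf T U) (hτ : τ ∈ Ioo ts T) :
    ContinuousAt (sideGrad u xs σ) τ :=
  H.continuousAt_trace hτ (H.shock.tendsto_grad σ)

theorem continuousAt_shockVel (H : ShockSetup u xs ts tf T U) (hτ : τ ∈ Ioo ts T) :
    ContinuousAt (shockVel u xs) τ :=
  ((H.continuousAt_sideVel hτ).add (H.continuousAt_sideVel hτ)).div_const 2

/-! ### The smooth region -/

theorem mem_smoothRegion {z : ℝ × ℝ} : z ∈ smoothRegion xs ts T U ↔
    z ∈ U ∧ z.2 ∈ Ioo 0 T ∧ (ts ≤ z.2 → z.1 ≠ xs z.2) := by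
  obtain ⟨x, t⟩ := z
  simp only [smoothRegion, shockSet, Set.mem_sdiff, mem_inter_iff, mem_ofPred_eq, mem_union,
    mem_singleton_iff, Prod.mk.injEq, not_or, mem_Ioo]
  constructor
  · rintro ⟨⟨hU, h0, hT⟩, h1, h2⟩
    refine ⟨hU, ⟨h0, hT⟩, fun hts hx => ?_⟩
    rcases hts.eq_or_lt with rfl | h
    · exact h2 ⟨hx, rfl⟩
    · exact h1 ⟨⟨h, hT⟩, hx⟩
  · rintro ⟨hU, ⟨h0, hT⟩, h⟩
    refine ⟨⟨hU, h0, hT⟩, fun h1 => h h1.1.1.le h1.2, fun h2 => h h2.2.ge ?_⟩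
    rw [h2.1, h2.2]

theorem smoothRegion_subset : smoothRegion xs ts T U ⊆ univ ×ˢ Ioo 0 T := fun _ hz =>
  ⟨mem_univ _, (mem_smoothRegion.1 hz).2.1⟩

/-- The shock together with its starting point is closed at times below `T`. -/
theorem isOpen_smoothRegion (H : ShockSetup u xs ts tf T U) : IsOpen (smoothRegion xs ts T U) := by
  set O : Set (ℝ × ℝ) := U ∩ {z | z.2 ∈ Ioo 0 T} with hO
  have hOo : IsOpen O := H.isOpen.inter (isOpen_Ioo.preimage continuous_snd)
  have hc : ContinuousOn (fun z : ℝ × ℝ => z.1 - xs (max ts z.2)) O := by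
    refine continuousOn_fst.sub (H.shock.continuousOn_curve.comp
      (continuous_const.max continuous_snd).continuousOn fun z hz => ?_)
    exact ⟨le_max_left _ _, max_lt (H.ts_lt_tf.trans H.tf_lt) hz.2.2⟩
  have h1 := hc.isOpen_inter_preimage hOo (isOpen_compl_singleton (x := (0 : ℝ)))
  have h2 : IsOpen (O ∩ {z | z.2 < ts}) := hOo.inter (isOpen_Iio.preimage continuous_snd)
  convert h1.union h2 using 1
  ext z
  simp only [mem_smoothRegion, hO, mem_union, mem_inter_iff, mem_preimage, mem_compl_iff,
    mem_singleton_iff, mem_ofPred_eq, sub_eq_zero]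
  rcases lt_or_ge z.2 ts with h | h
  · simp [h, not_le.2 h]
    tauto
  · simp [h, not_lt.2 h]
    tauto

theorem hasFDerivAt (H : ShockSetup u xs ts tf T U) {z : ℝ × ℝ} (hz : z ∈ smoothRegion xs ts T U) :
    HasFDerivAt (fun z : ℝ × ℝ => u z.1 z.2) (fderiv ℝ (fun z : ℝ × ℝ => u z.1 z.2) z) z :=
  ((H.contDiffOn.differentiableOn one_ne_zero).differentiableAt
    (H.isOpen_smoothRegion.mem_nhds hz)).hasFDerivAt

theorem deriv_eq_fderiv (H : ShockSetup u xs ts tf T U) {z : ℝ × ℝ}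
    (hz : z ∈ smoothRegion xs ts T U) :
    deriv (fun y => u y z.2) z.1 = fderiv ℝ (fun z : ℝ × ℝ => u z.1 z.2) z (1, 0) := by
  have h1 : HasDerivAt (fun y : ℝ => (y, z.2)) ((1 : ℝ), (0 : ℝ)) z.1 :=
    (hasDerivAt_id z.1).prodMk (hasDerivAt_const _ _)
  have h2 : HasFDerivAt (fun z : ℝ × ℝ => u z.1 z.2) _ (z.1, z.2) := H.hasFDerivAt hz
  exact (h2.comp_hasDerivAt z.1 h1).deriv

/-- The Burgers equation in the smooth region: along a curve of speed `c`, the field changes at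
the rate `(c - u) ∂u/∂x`. -/
theorem hasDerivAt_along (H : ShockSetup u xs ts tf T U) {γ : ℝ → ℝ} {c : ℝ}
    (hγ : HasDerivAt γ c t) (hz : (γ t, t) ∈ smoothRegion xs ts T U) :
    HasDerivAt (fun t => u (γ t) t) ((c - u (γ t) t) * deriv (fun y => u y t) (γ t)) t := by
  have h1 : HasDerivAt (fun s => (γ s, s)) (c, (1 : ℝ)) t := hγ.prodMk (hasDerivAt_id t)
  have h2 := HasFDerivAt.comp_hasDerivAt (f := fun s => (γ s, s)) t (H.hasFDerivAt hz) h1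
  refine h2.congr_deriv ?_
  have h3 := H.weak.fderiv_eq_zero H.isOpen_smoothRegion smoothRegion_subset H.contDiffOn hz
  have h4 := H.deriv_eq_fderiv hz
  simp only at h3 h4
  rw [h4]
  have h5 : ((c, 1) : ℝ × ℝ) = c • (1, 0) + (0, 1) := by simp
  rw [h5, map_add, map_smul, smul_eq_mul]
  linear_combination h3

theorem continuousOn_deriv (H : ShockSetup u xs ts tf T U) :
    ContinuousOn (fun z : ℝ × ℝ => deriv (fun y => u y z.2) z.1) (smoothRegion xs ts T U) := by
  have h := (H.contDiffOn.continuousOn_fderiv_of_isOpen H.isOpen_smoothRegion le_rfl).clm_apply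
    (continuousOn_const (c := ((1 : ℝ), (0 : ℝ))))
  exact h.congr fun z hz => H.deriv_eq_fderiv hz

/-! ### Constancy along characteristics -/

theorem eventually_side_charLine_pos (H : ShockSetup u xs ts tf T U) (hτ : τ ∈ Ioo ts T) :
    ∀ᶠ t in 𝓝[<] τ, 0 < side σ * (charLine u xs σ τ t - xs t) := by
  -- the gap vanishes at `τ`, where its derivative has a sign by the entropy condition
  have h := ((H.hasDerivAt_curve hτ).sub (hasDerivAt_charLine (u := u) (xs := xs) (σ := σ)
    (τ := τ))).const_mul (side σ)
  filter_upwards [(eventually_pos_of_hasDerivAt h (H.side_mul_shockVel_sub_pos hτ)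
    (by simp [charLine_self])).2] with t ht
  simp only [Pi.sub_apply] at ht
  linarith

theorem tendsto_charLine_sideSet {r τ' : ℝ} {l : Filter ℝ} (hl : l ≤ 𝓝 r)
    (hr : charLine u xs σ τ' r = xs r)
    (h : ∀ᶠ t in l, t ∈ Ioo ts T ∧ 0 < side σ * (charLine u xs σ τ' t - xs t)) :
    Tendsto (fun t => (charLine u xs σ τ' t, t)) l (𝓝[sideSet xs ts T σ] (xs r, r)) := by
  refine tendsto_nhdsWithin_iff.2 ⟨Tendsto.prodMk_nhds ?_ hl, ?_⟩
  · rw [← hr]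
    exact continuous_charLine.continuousAt.mono_left hl
  · exact h.mono fun t ht => mem_sideSet.2 ht

/-- The field is constant along a characteristic as long as it stays in the smooth region. -/
theorem eq_sideVel_of_mem (H : ShockSetup u xs ts tf T U) (hτ : τ ∈ Ioo ts T) {r : ℝ}
    (hV : ∀ t ∈ Ioo r τ, (charLine u xs σ τ t, t) ∈ smoothRegion xs ts T U) :
    ∀ t ∈ Ioo r τ, u (charLine u xs σ τ t) t = sideVel u xs σ τ := by
  intro t ht
  have hlim : Tendsto (fun t => (charLine u xs σ τ t, t)) (𝓝[<] τ)
      (𝓝[sideSet xs ts T σ] (xs τ, τ)) := by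
    refine tendsto_charLine_sideSet nhdsWithin_le_nhds charLine_self ?_
    filter_upwards [H.eventually_side_charLine_pos hτ, Ioo_mem_nhdsLT hτ.1] with t h1 h2
    exact ⟨⟨h2.1, h2.2.trans hτ.2⟩, h1⟩
  have hcont : Continuous fun t => (charLine u xs σ τ t, t) :=
    continuous_charLine.prodMk continuous_id
  -- the Burgers equation is linear in the deviation from the limit value at the shock
  have := eq_zero_of_hasDerivAt_mul_of_tendsto_zero
    (w := fun t => u (charLine u xs σ τ t) t - sideVel u xs σ τ)
    (c := fun t => - deriv (fun y => u y t) (charLine u xs σ τ t)) (a := r) (b := τ)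
    (k := - sideGrad u xs σ τ) ?_ ?_ ?_ ?_ t ht
  · exact sub_eq_zero.1 this
  · intro s hs
    exact ((H.hasDerivAt_along hasDerivAt_charLine (hV s hs)).sub_const _).congr_deriv (by ring)
  · exact (H.continuousOn_deriv.comp hcont.continuousOn hV).neg
  · exact ((H.shock.tendsto_grad σ τ hτ).comp hlim).neg
  · simpa using ((H.shock.tendsto_vel σ τ hτ).comp hlim).sub_const (sideVel u xs σ τ)

/-- A characteristic that carries a constant value and stays on its side of the shock after time
`r` cannot meet the shock at time `r`: it would leave the shock at its own side's velocity. -/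
theorem side_charLine_pos_of_forall (H : ShockSetup u xs ts tf T U) (hτ : τ ∈ Ioo ts T) {r : ℝ}
    (hr : r ∈ Ioo ts τ)
    (hpos : ∀ t ∈ Ioo r τ, 0 < side σ * (charLine u xs σ τ t - xs t))
    (hval : ∀ t ∈ Ioo r τ, u (charLine u xs σ τ t) t = sideVel u xs σ τ) :
    0 < side σ * (charLine u xs σ τ r - xs r) := by
  have hrT : r ∈ Ioo ts T := ⟨hr.1, hr.2.trans hτ.2⟩
  have hmem : Ioo r τ ∈ 𝓝[>] r := Ioo_mem_nhdsGT hr.2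
  have hnn : 0 ≤ side σ * (charLine u xs σ τ r - xs r) := by
    have hc : ContinuousAt (fun t => side σ * (charLine u xs σ τ t - xs t)) r :=
      continuousAt_const.mul (continuous_charLine.continuousAt.sub (H.continuousAt_curve hrT))
    refine ge_of_tendsto (hc.mono_left (nhdsWithin_le_nhds (s := Ioi r))) ?_
    filter_upwards [hmem] with t ht using (hpos t ht).le
  refine hnn.lt_of_ne fun h0 => ?_
  have hs : side σ ≠ 0 := by cases σ <;> norm_num [side]
  have heq : charLine u xs σ τ r = xs r := by
    rcases mul_eq_zero.1 h0.symm with h | h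
    · exact absurd h hs
    · linarith
  have hlim : Tendsto (fun t => (charLine u xs σ τ t, t)) (𝓝[>] r)
      (𝓝[sideSet xs ts T σ] (xs r, r)) := by
    refine tendsto_charLine_sideSet nhdsWithin_le_nhds heq ?_
    filter_upwards [hmem] with t ht
    exact ⟨⟨hr.1.trans ht.1, ht.2.trans hτ.2⟩, hpos t ht⟩
  -- at the meeting point the trace is the value carried by the characteristic, so the strict
  -- entropy inequality at time `r` puts the characteristic on the wrong side just after `r`
  have hvel : sideVel u xs σ r = sideVel u xs σ τ := by
    refine tendsto_nhds_unique ((H.shock.tendsto_vel σ r hrT).comp hlim)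
      (tendsto_const_nhds.congr' ?_)
    filter_upwards [hmem] with t ht using (hval t ht).symm
  have hd := ((H.hasDerivAt_curve hrT).sub (hasDerivAt_charLine (u := u) (xs := xs) (σ := σ)
    (τ := τ))).const_mul (side σ)
  have hev := (eventually_pos_of_hasDerivAt hd (by
    rw [← hvel]; exact H.side_mul_shockVel_sub_pos hrT) (by simp [heq])).1
  obtain ⟨t, h1, h2⟩ := (hev.and hmem).exists
  have := hpos t h2
  simp only [Pi.sub_apply] at h1
  linarith

end ShockSetup

namespace ShockSetup

/-! ### Characteristics in the shock triangle -/

theorem tf_mem (H : ShockSetup u xs ts tf T U) : tf ∈ Ioo ts T := ⟨H.ts_lt_tf, H.tf_lt⟩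

theorem mem_Ioo_of_mem_Ioc (H : ShockSetup u xs ts tf T U) (hτ : τ ∈ Ioc ts tf) : τ ∈ Ioo ts T :=
  ⟨hτ.1, hτ.2.trans_lt H.tf_lt⟩

theorem mem_smoothRegion_of_mem_shockTriangle (H : ShockSetup u xs ts tf T U) {x : ℝ}
    (hz : (x, t) ∈ shockTriangle u xs tf) (h0 : 0 < t) (hx : ts ≤ t → x ≠ xs t) :
    (x, t) ∈ smoothRegion xs ts T U :=
  mem_smoothRegion.2 ⟨H.triangle_subset hz, ⟨h0, (mem_shockTriangle.1 hz).1.2.trans_lt H.tf_lt⟩, hx⟩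

theorem charLine_tf_mem_shockTriangle (H : ShockSetup u xs ts tf T U) (ht : t ∈ Icc 0 tf) :
    (charLine u xs σ tf t, t) ∈ shockTriangle u xs tf := by
  refine mem_shockTriangle.2 ⟨ht, fun σ' => ?_⟩
  have h1 := H.shock.admissible tf H.tf_mem
  have h2 : 0 ≤ (sideVel u xs false tf - sideVel u xs true tf) * (tf - t) :=
    mul_nonneg (by linarith) (by linarith [ht.2])
  cases σ <;> cases σ' <;> simp only [charLine, side] <;> linarith

theorem ne_of_side_mul_pos {x y : ℝ} (h : 0 < side σ * (x - y)) : x ≠ y := by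
  rintro rfl
  simp at h

/-- The shock stays strictly inside the triangle of the particles that it absorbs. -/
theorem side_charLine_tf_sub_curve_pos (H : ShockSetup u xs ts tf T U) :
    ∀ t ∈ Ioo ts tf, ∀ σ, 0 < side σ * (charLine u xs σ tf t - xs t) := by
  refine forall_mem_Ioo_of_backward ?_ ?_ ?_
  · exact eventually_all.2 fun σ => H.eventually_side_charLine_pos H.tf_mem
  · intro t ht hP
    refine eventually_all.2 fun σ => ?_
    have hc : ContinuousAt (fun t => side σ * (charLine u xs σ tf t - xs t)) t :=
      continuousAt_const.mul (continuous_charLine.continuousAt.sub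
        (H.continuousAt_curve ⟨ht.1, ht.2.trans H.tf_lt⟩))
    exact (hc.eventually (lt_mem_nhds (hP σ))).filter_mono nhdsWithin_le_nhds
  · intro t ht hP σ
    have hpos : ∀ s ∈ Ioo t tf, 0 < s := fun s hs => H.ts_pos.trans (ht.1.trans hs.1)
    refine H.side_charLine_pos_of_forall H.tf_mem ht (fun s hs => hP s hs σ)
      (H.eq_sideVel_of_mem H.tf_mem fun s hs => ?_)
    exact H.mem_smoothRegion_of_mem_shockTriangle
      (H.charLine_tf_mem_shockTriangle ⟨(hpos s hs).le, hs.2.le⟩) (hpos s hs)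
      fun _ => ne_of_side_mul_pos (hP s hs σ)

theorem curve_mem_shockTriangle (H : ShockSetup u xs ts tf T U) (ht : t ∈ Icc ts tf) :
    (xs t, t) ∈ shockTriangle u xs tf := by
  have hopen : ∀ t ∈ Ioo ts tf, (xs t, t) ∈ shockTriangle u xs tf := fun t ht =>
    mem_shockTriangle.2 ⟨⟨(H.ts_pos.trans ht.1).le, ht.2.le⟩,
      fun σ => (H.side_charLine_tf_sub_curve_pos t ht σ).le⟩
  rcases ht.1.eq_or_lt with rfl | h1
  · have hlim : Tendsto (fun t => (xs t, t)) (𝓝[>] ts) (𝓝 (xs ts, ts)) :=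
      Tendsto.prodMk_nhds ((H.continuousWithinAt_curve
        ⟨le_rfl, H.ts_lt_tf.trans H.tf_lt⟩).mono Ioi_subset_Ici_self) nhdsWithin_le_nhds
    refine isClosed_shockTriangle.mem_of_tendsto hlim ?_
    filter_upwards [Ioo_mem_nhdsGT H.ts_lt_tf] with s hs using hopen s hs
  · rcases ht.2.eq_or_lt with rfl | h2
    · rw [← charLine_self (u := u) (xs := xs) (σ := true)]
      exact H.charLine_tf_mem_shockTriangle ⟨(H.ts_pos.trans h1).le, le_rfl⟩
    · exact hopen t ⟨h1, h2⟩

theorem charLine_sub_eq {σ σ' : Bool} {τ τ' : ℝ} (h : sideVel u xs σ τ = sideVel u xs σ' τ')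
    (s t : ℝ) : charLine u xs σ τ t - charLine u xs σ' τ' t =
      charLine u xs σ τ s - charLine u xs σ' τ' s := by
  simp only [charLine, h]
  ring

/-- Two characteristics on which the field is constant do not cross. -/
theorem side_mul_charLine_sub_pos {σ σ' ρ : Bool} {τ τ' b : ℝ}
    (hb : 0 < side ρ * (charLine u xs σ τ b - charLine u xs σ' τ' b)) (htb : t < b)
    (h1 : ∀ s ∈ Ico t b, u (charLine u xs σ τ s) s = sideVel u xs σ τ)
    (h2 : ∀ s ∈ Ico t b, u (charLine u xs σ' τ' s) s = sideVel u xs σ' τ') :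
    0 < side ρ * (charLine u xs σ τ t - charLine u xs σ' τ' t) := by
  by_contra! hneg
  have hc : Continuous fun s => side ρ * (charLine u xs σ τ s - charLine u xs σ' τ' s) :=
    continuous_const.mul (continuous_charLine.sub continuous_charLine)
  obtain ⟨s, hs, hs0⟩ := intermediate_value_Ico htb.le hc.continuousOn ⟨hneg, hb⟩
  have hs0 : side ρ * (charLine u xs σ τ s - charLine u xs σ' τ' s) = 0 := hs0
  have hρ : side ρ ≠ 0 := by cases ρ <;> norm_num [side]
  have heq := (mul_eq_zero.1 hs0).resolve_left hρ
  have hv : sideVel u xs σ τ = sideVel u xs σ' τ' := by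
    rw [← h1 s hs, ← h2 s hs, sub_eq_zero.1 heq]
  rw [charLine_sub_eq hv s b, heq, mul_zero] at hb
  exact lt_irrefl _ hb

theorem charLine_tf_mem_smoothRegion (H : ShockSetup u xs ts tf T U) {r : ℝ} (hr : 0 ≤ r)
    (hts : ts ≤ r ∨ charLine u xs σ tf ts ≠ xs ts) :
    ∀ t ∈ Ioo r tf, (charLine u xs σ tf t, t) ∈ smoothRegion xs ts T U := by
  intro t ht
  have h0 : 0 < t := hr.trans_lt ht.1
  refine H.mem_smoothRegion_of_mem_shockTriangle
    (H.charLine_tf_mem_shockTriangle ⟨h0.le, ht.2.le⟩) h0 fun h => ?_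
  rcases h.eq_or_lt with rfl | h
  · exact hts.resolve_left (not_le.2 ht.1)
  · exact ne_of_side_mul_pos (H.side_charLine_tf_sub_curve_pos t ⟨h, ht.2⟩ σ)

/-- A backward characteristic leaving the shock at a time `τ < tf` stays, down to a time `r`,
strictly between the two extreme ones and on its side of the shock. The range of times reaches
below the formation time `ts` only if no characteristic passes through the formation point. -/
theorem charLine_between (H : ShockSetup u xs ts tf T U) {r : ℝ} (hr : 0 ≤ r)
    (hts : ts ≤ r ∨ ∀ σ, ∀ τ ∈ Ioc ts tf, 0 < side σ * (charLine u xs σ τ ts - xs ts))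
    (hτ : τ ∈ Ioo ts tf) :
    ∀ t ∈ Ioo r τ, (∀ σ', 0 < side σ' * (charLine u xs σ' tf t - charLine u xs σ τ t)) ∧
      (ts ≤ t → 0 < side σ * (charLine u xs σ τ t - xs t)) := by
  have hτT : τ ∈ Ioo ts T := ⟨hτ.1, hτ.2.trans H.tf_lt⟩
  have hbar : ∀ σ', Continuous fun t =>
      side σ' * (charLine u xs σ' tf t - charLine u xs σ τ t) := fun σ' =>
    continuous_const.mul (continuous_charLine.sub continuous_charLine)
  have htf : ∀ σ, ∀ t ∈ Ioo r tf, u (charLine u xs σ tf t) t = sideVel u xs σ tf := fun σ =>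
    H.eq_sideVel_of_mem H.tf_mem (H.charLine_tf_mem_smoothRegion hr
      (hts.imp_right fun h => ne_of_side_mul_pos (h σ tf ⟨H.ts_lt_tf, le_rfl⟩)))
  refine forall_mem_Ioo_of_backward ?_ ?_ ?_
  · refine (eventually_all.2 fun σ' => ?_).and ?_
    · refine ((hbar σ').continuousAt.eventually (lt_mem_nhds ?_)).filter_mono nhdsWithin_le_nhds
      simp only [charLine_self (τ := τ)]
      exact H.side_charLine_tf_sub_curve_pos τ hτ σ'
    · exact (H.eventually_side_charLine_pos hτT).mono fun t ht _ => ht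
  · intro t ht hP
    refine (eventually_all.2 fun σ' => ?_).and ?_
    · exact ((hbar σ').continuousAt.eventually (lt_mem_nhds (hP.1 σ'))).filter_mono
        nhdsWithin_le_nhds
    · rcases lt_or_ge ts t with h | h
      · have hc : ContinuousAt (fun t => side σ * (charLine u xs σ τ t - xs t)) t :=
          continuousAt_const.mul (continuous_charLine.continuousAt.sub
            (H.continuousAt_curve ⟨h, ht.2.trans hτT.2⟩))
        exact ((hc.eventually (lt_mem_nhds (hP.2 h.le))).filter_mono nhdsWithin_le_nhds).mono
          fun s hs _ => hs
      · filter_upwards [self_mem_nhdsWithin] with s hs hs'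
        exact absurd (hs'.trans_lt hs) (not_lt.2 h)
  · intro t ht hP
    have hval : ∀ s ∈ Ioo t τ, u (charLine u xs σ τ s) s = sideVel u xs σ τ := by
      refine H.eq_sideVel_of_mem hτT fun s hs => ?_
      have h0 : 0 < s := hr.trans_lt (ht.1.trans hs.1)
      refine H.mem_smoothRegion_of_mem_shockTriangle (mem_shockTriangle.2
        ⟨⟨h0.le, (hs.2.trans hτ.2).le⟩, fun σ' => ((hP s hs).1 σ').le⟩) h0 fun h => ?_
      exact ne_of_side_mul_pos ((hP s hs).2 h)
    have hcurve : ts ≤ t → 0 < side σ * (charLine u xs σ τ t - xs t) := by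
      intro h
      rcases h.eq_or_lt with rfl | h
      · exact hts.resolve_left (not_le.2 ht.1) σ τ ⟨hτ.1, hτ.2.le⟩
      · exact H.side_charLine_pos_of_forall hτT ⟨h, ht.2⟩
          (fun s hs => (hP s hs).2 (h.trans hs.1).le) hval
    refine ⟨fun σ' => ?_, hcurve⟩
    -- the characteristic is still inside the closed triangle at time `t`, hence so is the value
    have hmem : (charLine u xs σ τ t, t) ∈ shockTriangle u xs tf := by
      have h0 : 0 < t := hr.trans_lt ht.1
      refine mem_shockTriangle.2 ⟨⟨h0.le, (ht.2.trans hτ.2).le⟩, fun σ' => ?_⟩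
      refine ge_of_tendsto ((hbar σ').continuousAt.mono_left
        (nhdsWithin_le_nhds (s := Ioi t))) ?_
      filter_upwards [Ioo_mem_nhdsGT ht.2] with s hs using ((hP s hs).1 σ').le
    have hvalt : u (charLine u xs σ τ t) t = sideVel u xs σ τ := by
      have hV := H.mem_smoothRegion_of_mem_shockTriangle hmem (hr.trans_lt ht.1)
        fun h => ne_of_side_mul_pos (hcurve h)
      have hc : ContinuousAt (fun z : ℝ × ℝ => u z.1 z.2) (charLine u xs σ τ t, t) :=
        (H.hasFDerivAt hV).continuousAt
      have hline : Tendsto (fun s => (charLine u xs σ τ s, s)) (𝓝[>] t)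
          (𝓝 (charLine u xs σ τ t, t)) :=
        ((continuous_charLine.prodMk continuous_id).tendsto t).mono_left nhdsWithin_le_nhds
      refine tendsto_nhds_unique (hc.tendsto.comp hline) (tendsto_const_nhds.congr' ?_)
      filter_upwards [Ioo_mem_nhdsGT ht.2] with s hs using (hval s hs).symm
    have hsub : ∀ s ∈ Ico t τ, s ∈ Ioo r tf := fun s hs =>
      ⟨ht.1.trans_le hs.1, hs.2.trans hτ.2⟩
    refine side_mul_charLine_sub_pos (b := τ) ?_ ht.2 (fun s hs => htf σ' s (hsub s hs)) ?_
    · rw [charLine_self (τ := τ)]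
      exact H.side_charLine_tf_sub_curve_pos τ hτ σ'
    · intro s hs
      rcases hs.1.eq_or_lt with rfl | h
      · exact hvalt
      · exact hval s ⟨h, hs.2⟩

/-- The characteristics that enter the shock stay in the triangle, on their side of the shock, and
carry a constant value, down to a time `r` as in `charLine_between`. -/
theorem charLine_mem (H : ShockSetup u xs ts tf T U) {r : ℝ} (hr : 0 ≤ r)
    (hts : ts ≤ r ∨ ∀ σ, ∀ τ ∈ Ioc ts tf, 0 < side σ * (charLine u xs σ τ ts - xs ts))
    (hτ : τ ∈ Ioc ts tf) :
    ∀ t ∈ Ioo r τ, (charLine u xs σ τ t, t) ∈ shockTriangle u xs tf ∧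
      (ts ≤ t → 0 < side σ * (charLine u xs σ τ t - xs t)) ∧
      u (charLine u xs σ τ t) t = sideVel u xs σ τ := by
  have key : ∀ t ∈ Ioo r τ, (charLine u xs σ τ t, t) ∈ shockTriangle u xs tf ∧
      (ts ≤ t → 0 < side σ * (charLine u xs σ τ t - xs t)) := by
    intro t ht
    have h0 : 0 < t := hr.trans_lt ht.1
    rcases hτ.2.eq_or_lt with rfl | hlt
    · refine ⟨H.charLine_tf_mem_shockTriangle ⟨h0.le, ht.2.le⟩, fun h => ?_⟩
      rcases h.eq_or_lt with rfl | h
      · exact hts.resolve_left (not_le.2 ht.1) σ τ hτ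
      · exact H.side_charLine_tf_sub_curve_pos t ⟨h, ht.2⟩ σ
    · obtain ⟨h1, h2⟩ := H.charLine_between (σ := σ) hr hts ⟨hτ.1, hlt⟩ t ht
      exact ⟨mem_shockTriangle.2 ⟨⟨h0.le, (ht.2.trans hlt).le⟩, fun σ' => (h1 σ').le⟩, h2⟩
  have hval := H.eq_sideVel_of_mem (σ := σ) (H.mem_Ioo_of_mem_Ioc hτ) (r := r) fun t ht =>
    H.mem_smoothRegion_of_mem_shockTriangle (key t ht).1 (hr.trans_lt ht.1)
      fun h => ne_of_side_mul_pos ((key t ht).2 h)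
  exact fun t ht => ⟨(key t ht).1, (key t ht).2, hval t ht⟩

/-- Continuity of the field at the points of the triangle off the shock, including those at time
`0` and the formation point. -/
theorem tendsto_of_mem (H : ShockSetup u xs ts tf T U) {ι : Type*} {l : Filter ι}
    {γ : ι → ℝ × ℝ} {x : ℝ} (hz : (x, t) ∈ shockTriangle u xs tf) (hx : ts < t → x ≠ xs t)
    (hγ : Tendsto γ l (𝓝 (x, t)))
    (hγ' : ∀ᶠ i in l, 0 ≤ (γ i).2 ∧ (ts < (γ i).2 → (γ i).1 ≠ xs (γ i).2)) :
    Tendsto (fun i => u (γ i).1 (γ i).2) l (𝓝 (u x t)) := by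
  have htT := (mem_shockTriangle.1 hz).1
  have hmem : (x, t) ∈ (U ∩ {z | z.2 ∈ Ico 0 T}) \ shockSet xs ts T :=
    ⟨⟨H.triangle_subset hz, htT.1, htT.2.trans_lt H.tf_lt⟩, fun h => hx h.1.1 h.2⟩
  refine (H.continuousOn _ hmem).tendsto.comp (tendsto_nhdsWithin_iff.2 ⟨hγ, ?_⟩)
  have hT : ∀ᶠ z : ℝ × ℝ in 𝓝 (x, t), z.2 < T :=
    continuous_snd.continuousAt.eventually (gt_mem_nhds (htT.2.trans_lt H.tf_lt))
  filter_upwards [hγ', hγ.eventually hT,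
    hγ.eventually (H.isOpen.mem_nhds (H.triangle_subset hz))] with i h1 h2 h3
  exact ⟨⟨h3, h1.1, h2⟩, fun h => h1.2 h.1.1 h.2⟩

/-- No characteristic that enters the shock passes through the formation point: the earlier ones
on the same side would be squeezed through it as well, all with the same velocity. -/
theorem side_charLine_ts_pos (H : ShockSetup u xs ts tf T U) (hτ : τ ∈ Ioc ts tf) :
    0 < side σ * (charLine u xs σ τ ts - xs ts) := by
  have hmem : ∀ τ ∈ Ioc ts tf, ∀ t ∈ Ioo ts τ, _ := fun τ hτ =>
    H.charLine_mem (σ := σ) H.ts_pos.le (Or.inl le_rfl) hτ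
  have htsT : ts ∈ Ico ts T := ⟨le_rfl, H.ts_lt_tf.trans H.tf_lt⟩
  have hcurve : Tendsto xs (𝓝[>] ts) (𝓝 (xs ts)) :=
    (H.continuousWithinAt_curve htsT).mono Ioi_subset_Ici_self
  have hline : ∀ τ, Tendsto (charLine u xs σ τ) (𝓝[>] ts) (𝓝 (charLine u xs σ τ ts)) := fun τ =>
    continuous_charLine.continuousAt.mono_left nhdsWithin_le_nhds
  have hnn : ∀ τ ∈ Ioc ts tf, 0 ≤ side σ * (charLine u xs σ τ ts - xs ts) := by
    intro τ hτ
    refine ge_of_tendsto (((hline τ).sub hcurve).const_mul (side σ)) ?_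
    filter_upwards [Ioo_mem_nhdsGT hτ.1] with t ht using ((hmem τ hτ t ht).2.1 ht.1.le).le
  refine (hnn τ hτ).lt_of_ne fun h0 => ?_
  have hσ : side σ ≠ 0 := by cases σ <;> norm_num [side]
  have hval : ∀ τ ∈ Ioc ts tf, side σ * (charLine u xs σ τ ts - xs ts) = 0 →
      charLine u xs σ τ ts = xs ts ∧ sideVel u xs σ τ = u (xs ts) ts := by
    intro τ hτ h
    have heq : charLine u xs σ τ ts = xs ts :=
      sub_eq_zero.1 ((mul_eq_zero.1 h).resolve_left hσ)
    refine ⟨heq, ?_⟩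
    have hl : Tendsto (fun t => (charLine u xs σ τ t, t)) (𝓝[>] ts) (𝓝 (xs ts, ts)) :=
      Tendsto.prodMk_nhds (heq ▸ hline τ) nhdsWithin_le_nhds
    have h1 := H.tendsto_of_mem (H.curve_mem_shockTriangle ⟨le_rfl, H.ts_lt_tf.le⟩)
      (fun h => absurd h (lt_irrefl _)) hl (by
        filter_upwards [Ioo_mem_nhdsGT hτ.1] with t ht
        exact ⟨(H.ts_pos.trans ht.1).le, fun h => ne_of_side_mul_pos ((hmem τ hτ t ht).2.1 h.le)⟩)
    refine tendsto_nhds_unique (tendsto_const_nhds.congr' ?_) h1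
    filter_upwards [Ioo_mem_nhdsGT hτ.1] with t ht using (hmem τ hτ t ht).2.2.symm
  -- an earlier characteristic lies between the given one and the shock
  obtain ⟨τ', h1, h2⟩ := exists_between hτ.1
  have hτ' : τ' ∈ Ioc ts tf := ⟨h1, h2.le.trans hτ.2⟩
  have hgap : 0 < side σ * (charLine u xs σ τ τ' - charLine u xs σ τ' τ') := by
    rw [charLine_self (τ := τ')]
    exact (hmem τ hτ τ' ⟨h1, h2⟩).2.1 h1.le
  have hle : 0 ≤ side σ * (charLine u xs σ τ ts - charLine u xs σ τ' ts) := by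
    refine ge_of_tendsto (((hline τ).sub (hline τ')).const_mul (side σ)) ?_
    filter_upwards [Ioo_mem_nhdsGT h1] with t ht
    refine (side_mul_charLine_sub_pos hgap ht.2 (fun s hs => ?_) fun s hs => ?_).le
    · exact (hmem τ hτ s ⟨ht.1.trans_le hs.1, hs.2.trans h2⟩).2.2
    · exact (hmem τ' hτ' s ⟨ht.1.trans_le hs.1, hs.2⟩).2.2
  obtain ⟨e1, e2⟩ := hval τ hτ h0.symm
  obtain ⟨e3, e4⟩ := hval τ' hτ' (le_antisymm (by rw [e1] at hle; linarith) (hnn τ' hτ'))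
  rw [charLine_sub_eq (e2.trans e4.symm) ts τ', e1, e3, sub_self, mul_zero] at hgap
  exact lt_irrefl _ hgap

/-- Every characteristic that enters the shock comes from time `0` inside the triangle, on its side
of the shock, and carries a constant value. -/
theorem charLine_mem_of_mem_Ioc (H : ShockSetup u xs ts tf T U) (hτ : τ ∈ Ioc ts tf)
    (ht : t ∈ Ico 0 τ) :
    (charLine u xs σ τ t, t) ∈ shockTriangle u xs tf ∧
      (ts ≤ t → 0 < side σ * (charLine u xs σ τ t - xs t)) ∧
      u (charLine u xs σ τ t) t = sideVel u xs σ τ := by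
  have hmem := H.charLine_mem (σ := σ) le_rfl (Or.inr fun σ τ hτ => H.side_charLine_ts_pos hτ) hτ
  rcases ht.1.eq_or_lt with rfl | h0
  · have hl : Tendsto (fun t => (charLine u xs σ τ t, t)) (𝓝[>] 0)
        (𝓝 (charLine u xs σ τ 0, 0)) :=
      ((continuous_charLine.prodMk continuous_id).tendsto 0).mono_left nhdsWithin_le_nhds
    have hev : Ioo 0 τ ∈ 𝓝[>] (0 : ℝ) := Ioo_mem_nhdsGT ht.2
    have hΔ : (charLine u xs σ τ 0, (0 : ℝ)) ∈ shockTriangle u xs tf := by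
      refine isClosed_shockTriangle.mem_of_tendsto hl ?_
      filter_upwards [hev] with t ht using (hmem t ht).1
    refine ⟨hΔ, fun h => absurd H.ts_pos (not_lt.2 h), ?_⟩
    have h1 := H.tendsto_of_mem hΔ (fun h => absurd H.ts_pos h.not_gt) hl (by
        filter_upwards [hev] with t ht
        exact ⟨ht.1.le, fun h => ne_of_side_mul_pos ((hmem t ht).2.1 h.le)⟩)
    refine tendsto_nhds_unique h1 (tendsto_const_nhds.congr' ?_)
    filter_upwards [hev] with t ht using (hmem t ht).2.2.symm
  · exact hmem t ⟨h0, ht.2⟩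

/-- At a fixed earlier time, the characteristics of one side are ordered by the time at which they
enter the shock. -/
theorem side_mul_charLine_sub_pos_of_lt (H : ShockSetup u xs ts tf T U) {τ' : ℝ}
    (hτ' : ts < τ') (hττ' : τ' < τ) (hτ : τ ≤ tf) (ht : t ∈ Ico 0 τ') :
    0 < side σ * (charLine u xs σ τ t - charLine u xs σ τ' t) := by
  have h1 : τ ∈ Ioc ts tf := ⟨hτ'.trans hττ', hτ⟩
  have h2 : τ' ∈ Ioc ts tf := ⟨hτ', hττ'.le.trans hτ⟩
  refine side_mul_charLine_sub_pos (b := τ') ?_ ht.2 (fun s hs => ?_) fun s hs => ?_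
  · rw [charLine_self (τ := τ')]
    exact (H.charLine_mem_of_mem_Ioc h1 ⟨(H.ts_pos.trans hτ').le, hττ'⟩).2.1 hτ'.le
  · exact (H.charLine_mem_of_mem_Ioc h1 ⟨ht.1.trans hs.1, hs.2.trans hττ'⟩).2.2
  · exact (H.charLine_mem_of_mem_Ioc h2 ⟨ht.1.trans hs.1, hs.2⟩).2.2

/-! ### The formation of the shock -/

/-- At the formation time the two traces agree. -/
theorem sideVel_ts (H : ShockSetup u xs ts tf T U) : sideVel u xs σ ts = u (xs ts) ts := by
  have h : ∀ l : Filter ℝ, l ≤ 𝓝 (xs ts) → Tendsto (fun x => u x ts) l (𝓝 (u (xs ts) ts)) := by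
    intro l hl
    exact H.tendsto_of_mem (γ := fun x => (x, ts))
      (H.curve_mem_shockTriangle ⟨le_rfl, H.ts_lt_tf.le⟩)
      (fun h => absurd h (lt_irrefl _)) (Tendsto.prodMk_nhds hl tendsto_const_nhds)
      (Eventually.of_forall fun x => ⟨H.ts_pos.le, fun h => absurd h (lt_irrefl _)⟩)
  cases σ
  · exact leftLim_eq_of_tendsto (h _ nhdsWithin_le_nhds)
  · exact rightLim_eq_of_tendsto (h _ nhdsWithin_le_nhds)

/-- The traces of the field have the value of the field at the formation point as a limit. -/
theorem tendsto_sideVel_ts (H : ShockSetup u xs ts tf T U) :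
    Tendsto (sideVel u xs σ) (𝓝[>] ts) (𝓝 (u (xs ts) ts)) := by
  refine H.tendsto_sideVel_of_tendsto ⟨le_rfl, H.ts_lt_tf.trans H.tf_lt⟩ ?_
  refine H.tendsto_of_mem (γ := id) (H.curve_mem_shockTriangle ⟨le_rfl, H.ts_lt_tf.le⟩)
    (fun h => absurd h (lt_irrefl _)) (tendsto_id.mono_left nhdsWithin_le_nhds) ?_
  filter_upwards [self_mem_nhdsWithin] with z hz
  have := mem_sideSet.1 hz
  exact ⟨(H.ts_pos.trans this.1.1).le, fun _ => ne_of_side_mul_pos this.2⟩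

theorem continuousOn_sideVel (H : ShockSetup u xs ts tf T U) :
    ContinuousOn (sideVel u xs σ) (Icc ts tf) := by
  intro t ht
  rcases ht.1.eq_or_lt with rfl | h
  · refine ContinuousWithinAt.mono ?_ Icc_subset_Ici_self
    rw [← continuousWithinAt_Ioi_iff_Ici, ContinuousWithinAt, H.sideVel_ts]
    exact H.tendsto_sideVel_ts
  · exact (H.continuousAt_sideVel ⟨h, ht.2.trans_lt H.tf_lt⟩).continuousWithinAt

theorem continuousOn_curve (H : ShockSetup u xs ts tf T U) : ContinuousOn xs (Icc ts tf) :=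
  H.shock.continuousOn_curve.mono fun _ ht => ⟨ht.1, ht.2.trans_lt H.tf_lt⟩

/-- The statement of `charLine_mem_of_mem_Ioc`, for the limiting characteristic through the
formation point as well. -/
theorem charLine_mem_of_mem_Icc (H : ShockSetup u xs ts tf T U) (hτ : τ ∈ Icc ts tf)
    (ht : t ∈ Ico 0 τ) :
    (charLine u xs σ τ t, t) ∈ shockTriangle u xs tf ∧
      (ts ≤ t → 0 < side σ * (charLine u xs σ τ t - xs t)) ∧
      u (charLine u xs σ τ t) t = sideVel u xs σ τ := by
  rcases hτ.1.eq_or_lt with rfl | h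
  · have hev : Ioo ts tf ∈ 𝓝[>] ts := Ioo_mem_nhdsGT H.ts_lt_tf
    have hmem : ∀ τ ∈ Ioo ts tf, _ := fun τ hτ =>
      H.charLine_mem_of_mem_Ioc (σ := σ) (t := t) ⟨hτ.1, hτ.2.le⟩ ⟨ht.1, ht.2.trans hτ.1⟩
    have hl : Tendsto (fun τ => (charLine u xs σ τ t, t)) (𝓝[>] ts)
        (𝓝 (charLine u xs σ ts t, t)) := by
      refine Tendsto.prodMk_nhds ?_ tendsto_const_nhds
      have h1 : Tendsto xs (𝓝[>] ts) (𝓝 (xs ts)) :=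
        (H.continuousWithinAt_curve ⟨le_rfl, H.ts_lt_tf.trans H.tf_lt⟩).mono Ioi_subset_Ici_self
      have h2 := H.tendsto_sideVel_ts (σ := σ)
      rw [← H.sideVel_ts (σ := σ)] at h2
      have h3 : Tendsto (fun τ => t - τ) (𝓝[>] ts) (𝓝 (t - ts)) :=
        (Continuous.tendsto (by fun_prop) ts).mono_left nhdsWithin_le_nhds
      exact h1.add (h2.mul h3)
    have hΔ : (charLine u xs σ ts t, t) ∈ shockTriangle u xs tf := by
      refine isClosed_shockTriangle.mem_of_tendsto hl ?_
      filter_upwards [hev] with τ hτ using (hmem τ hτ).1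
    refine ⟨hΔ, fun h => absurd ht.2 (not_lt.2 h), ?_⟩
    have h1 := H.tendsto_of_mem hΔ (fun h => absurd ht.2 h.not_gt) hl
      (Eventually.of_forall fun τ => ⟨ht.1, fun h => absurd ht.2 h.not_gt⟩)
    rw [H.sideVel_ts]
    refine tendsto_nhds_unique h1 (H.tendsto_sideVel_ts (σ := σ) |>.congr' ?_)
    filter_upwards [hev] with τ hτ using (hmem τ hτ).2.2.symm
  · exact H.charLine_mem_of_mem_Ioc ⟨h, hτ.2⟩ ht

end ShockSetup

/-- The velocity of the realization `ω` of the process at time `t`, in terms of the traces of the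
field at the shock. -/
noncomputable def branchVel (u : ℝ → ℝ → ℝ) (xs : ℝ → ℝ) (t : ℝ) (ω : Bool × ℝ) : ℝ :=
  if ω.2 ≤ t then shockVel u xs t else sideVel u xs ω.1 ω.2

namespace ShockSetup

/-! ### Derivatives of the traces -/

/-- The traces of the field at the shock are differentiable in time: their derivative is the limit
of those of the field along the translates of the shock. -/
theorem hasDerivAt_sideVel (H : ShockSetup u xs ts tf T U) (hτ : τ ∈ Ioc ts tf) :
    HasDerivAt (sideVel u xs σ)
      ((shockVel u xs τ - sideVel u xs σ τ) * sideGrad u xs σ τ) τ := by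
  have hτT := H.mem_Ioo_of_mem_Ioc hτ
  have hmem : ∀ t ∈ Ioo ts T, ∀ ε : ℝ, 0 < ε → (xs t + side σ * ε, t) ∈ sideSet xs ts T σ := by
    intro t ht ε hε
    refine mem_sideSet.2 ⟨ht, ?_⟩
    rw [add_sub_cancel_left, ← mul_assoc, side_mul_side, one_mul]
    exact hε
  have hev : ∀ᶠ q : ℝ × ℝ in 𝓝[>] 0 ×ˢ 𝓝 τ, 0 < q.1 ∧ q.2 ∈ Ioo ts T :=
    prod_mem_prod self_mem_nhdsWithin (Ioo_mem_nhds hτT.1 hτT.2)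
  have hto : Tendsto (fun q : ℝ × ℝ => (xs q.2 + side σ * q.1, q.2)) (𝓝[>] 0 ×ˢ 𝓝 τ)
      (𝓝[sideSet xs ts T σ] (xs τ, τ)) := by
    refine tendsto_nhdsWithin_iff.2 ⟨Tendsto.prodMk_nhds ?_ tendsto_snd, ?_⟩
    · have h1 : Tendsto (fun q : ℝ × ℝ => xs q.2) (𝓝[>] 0 ×ˢ 𝓝 τ) (𝓝 (xs τ)) :=
        (H.continuousAt_curve hτT).tendsto.comp tendsto_snd
      have h2 : Tendsto (fun q : ℝ × ℝ => q.1) (𝓝[>] 0 ×ˢ 𝓝 τ) (𝓝 0) :=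
        tendsto_fst.mono_right nhdsWithin_le_nhds
      simpa using h1.add (h2.const_mul (side σ))
    · filter_upwards [hev] with q hq using hmem q.2 hq.2 q.1 hq.1
  have hV : ∀ᶠ q : ℝ × ℝ in 𝓝[>] 0 ×ˢ 𝓝 τ,
      (xs q.2 + side σ * q.1, q.2) ∈ smoothRegion xs ts T U := by
    have hU : U ∈ 𝓝 (xs τ, τ) := H.isOpen.mem_nhds
      (H.triangle_subset (H.curve_mem_shockTriangle ⟨hτ.1.le, hτ.2⟩))
    filter_upwards [hev, (hto.mono_right nhdsWithin_le_nhds).eventually hU] with q hq hqU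
    exact mem_smoothRegion.2 ⟨hqU, ⟨H.ts_pos.trans hq.2.1, hq.2.2⟩,
      fun _ => ne_of_side_mul_pos (mem_sideSet.1 (hmem q.2 hq.2 q.1 hq.1)).2⟩
  refine hasDerivAt_of_tendstoUniformlyOnFilter (l := 𝓝[>] (0 : ℝ))
    (f := fun ε t => u (xs t + side σ * ε) t)
    (f' := fun ε t => (shockVel u xs t - u (xs t + side σ * ε) t) *
      deriv (fun y => u y t) (xs t + side σ * ε))
    (g' := fun t => (shockVel u xs t - sideVel u xs σ t) * sideGrad u xs σ t) ?_ ?_ ?_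
  · rw [tendstoUniformlyOnFilter_iff_tendsto]
    have h1 : Tendsto (fun q : ℝ × ℝ => shockVel u xs q.2) (𝓝[>] 0 ×ˢ 𝓝 τ)
        (𝓝 (shockVel u xs τ)) := (H.continuousAt_shockVel hτT).tendsto.comp tendsto_snd
    have h2 := (((H.continuousAt_shockVel hτT).sub (H.continuousAt_sideVel (σ := σ) hτT)).mul
      (H.continuousAt_sideGrad (σ := σ) hτT)).tendsto.comp (tendsto_snd (f := 𝓝[>] (0 : ℝ)))
    have h3 := (h1.sub ((H.shock.tendsto_vel σ τ hτT).comp hto)).mul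
      ((H.shock.tendsto_grad σ τ hτT).comp hto)
    exact (h2.prodMk_nhds h3).mono_right (nhds_le_uniformity _)
  · filter_upwards [hev, hV] with q hq hqV
    exact H.hasDerivAt_along ((H.hasDerivAt_curve hq.2).add_const (side σ * q.1)) hqV
  · filter_upwards [Ioo_mem_nhds hτT.1 hτT.2] with t ht
    refine (H.shock.tendsto_vel σ t ht).comp
      (f := fun ε => (xs t + side σ * ε, t)) (tendsto_nhdsWithin_iff.2 ⟨?_, ?_⟩)
    · have : Continuous fun ε : ℝ => (xs t + side σ * ε, t) := by fun_prop
      simpa using (this.tendsto 0).mono_left nhdsWithin_le_nhds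
    · filter_upwards [self_mem_nhdsWithin] with ε hε using hmem t ht ε hε

/-! ### The velocity of the realizations -/

/-- The right-hand velocity of the shock, including its starting time. -/
theorem hasDerivWithinAt_curve (H : ShockSetup u xs ts tf T U) (ht : t ∈ Icc ts tf) :
    HasDerivWithinAt xs (shockVel u xs t) (Ici t) t := by
  rcases ht.1.eq_or_lt with rfl | h
  · have hev : Ioo ts T ∈ 𝓝[>] ts := Ioo_mem_nhdsGT (H.ts_lt_tf.trans H.tf_lt)
    refine hasDerivWithinAt_Ici_of_tendsto_deriv (s := Ioo ts T) ?_ ?_ hev ?_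
    · exact fun s hs => (H.hasDerivAt_curve hs).differentiableAt.differentiableWithinAt
    · exact (H.continuousWithinAt_curve ⟨le_rfl, H.ts_lt_tf.trans H.tf_lt⟩).mono
        (Ioo_subset_Ioi_self.trans Ioi_subset_Ici_self)
    · have h1 : Tendsto (shockVel u xs) (𝓝[>] ts) (𝓝 (shockVel u xs ts)) := by
        refine Tendsto.div_const (Tendsto.add ?_ ?_) 2 <;>
        · rw [H.sideVel_ts]
          exact H.tendsto_sideVel_ts
      refine h1.congr' ?_
      filter_upwards [hev] with s hs using (H.hasDerivAt_curve hs).deriv.symm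
  · exact (H.hasDerivAt_curve ⟨h, ht.2.trans_lt H.tf_lt⟩).hasDerivWithinAt

theorem hasDerivWithinAt_path (H : ShockSetup u xs ts tf T U) {ω : Bool × ℝ}
    (hω : ω.2 ∈ Icc ts tf) (ht : t ∈ Icc 0 tf) :
    HasDerivWithinAt (path u xs ω) (branchVel u xs t ω) (Ici t) t := by
  by_cases h : ω.2 ≤ t
  · have hp : ∀ s, t ≤ s → path u xs ω s = xs s := fun s hs => if_pos (h.trans hs)
    rw [branchVel, if_pos h]
    exact (H.hasDerivWithinAt_curve ⟨hω.1.trans h, ht.2⟩).congr (fun s hs => hp s hs)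
      (hp t le_rfl)
  · rw [branchVel, if_neg h]
    refine (hasDerivAt_charLine (xs := xs)).hasDerivWithinAt.congr_of_eventuallyEq ?_ (if_neg h)
    filter_upwards [nhdsWithin_le_nhds (Iio_mem_nhds (not_le.1 h))] with s hs
    exact if_neg (not_le.2 hs)

/-- The mean field along a realization is the velocity of the realization: off the shock the field
is continuous and equals the value carried by the characteristic. -/
theorem uBar_path (H : ShockSetup u xs ts tf T U) {ω : Bool × ℝ}
    (hω : ω.2 ∈ Icc ts tf) (ht : t ∈ Icc 0 tf) :
    uBar u (path u xs ω t) t = branchVel u xs t ω := by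
  by_cases h : ω.2 ≤ t
  · rw [branchVel, if_pos h, path, if_pos h, uBar, shockVel, add_comm]
    rfl
  · have hp : path u xs ω t = charLine u xs ω.1 ω.2 t := if_neg h
    obtain ⟨h1, h2, h3⟩ := H.charLine_mem_of_mem_Icc (σ := ω.1) hω ⟨ht.1, not_le.1 h⟩
    rw [branchVel, if_neg h, hp, uBar_eq_of_continuousAt, h3]
    refine H.tendsto_of_mem (γ := fun x => (x, t)) h1 (fun h => ne_of_side_mul_pos (h2 h.le))
      (Tendsto.prodMk_nhds tendsto_id tendsto_const_nhds) ?_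
    by_cases hts : ts < t
    · filter_upwards [isOpen_ne.mem_nhds (ne_of_side_mul_pos (h2 hts.le))] with x hx
      exact ⟨ht.1, fun _ => hx⟩
    · exact Eventually.of_forall fun x => ⟨ht.1, fun h => absurd h hts⟩

theorem velocity_eq (H : ShockSetup u xs ts tf T U) {ω : Bool × ℝ}
    (hω : ω.2 ∈ Icc ts tf) (ht : t ∈ Icc 0 tf) : velocity u xs t ω = branchVel u xs t ω :=
  (H.hasDerivWithinAt_path hω ht).derivWithin (uniqueDiffWithinAt_Ici t)

/-! ### The branching density -/

variable {t0 : ℝ}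

theorem denominator_pos (H : ShockSetup u xs ts tf T U) (h0s : t0 < ts) :
    0 < (sideVel u xs false tf - sideVel u xs true tf) * (tf - t0) :=
  mul_pos (sub_pos.2 (H.shock.admissible tf H.tf_mem)) (by linarith [H.ts_lt_tf])

/-- The density of the branching time is the rate at which the shock absorbs the particles, in
terms of their positions at time `t0`. -/
theorem hasDerivAt_charLine_div (H : ShockSetup u xs ts tf T U) (hτ : τ ∈ Ioc ts tf) :
    HasDerivAt (fun τ => side σ * charLine u xs σ τ t0 /
        ((sideVel u xs false tf - sideVel u xs true tf) * (tf - t0)))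
      (branchDensity u xs t0 tf σ τ) τ := by
  have h1 := H.hasDerivAt_curve (H.mem_Ioo_of_mem_Ioc hτ)
  have h2 := H.hasDerivAt_sideVel (σ := σ) hτ
  have h3 := ((h1.add (h2.mul ((hasDerivAt_id τ).const_sub t0))).const_mul (side σ)).div_const
    ((sideVel u xs false tf - sideVel u xs true tf) * (tf - t0))
  refine h3.congr_deriv ?_
  have e : side σ * (shockVel u xs τ + ((shockVel u xs τ - sideVel u xs σ τ) * sideGrad u xs σ τ *
      (t0 - id τ) + sideVel u xs σ τ * -1)) =
      (sideVel u xs false τ - sideVel u xs true τ) * (1 - sideGrad u xs σ τ * (τ - t0)) / 2 := by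
    have e1 := shockVel_sub_sideVel u xs σ τ
    have e2 := side_mul_side σ
    simp only [id]
    linear_combination side σ * (1 - sideGrad u xs σ τ * (τ - t0)) * e1 +
      (sideVel u xs false τ - sideVel u xs true τ) / 2 *
        (1 - sideGrad u xs σ τ * (τ - t0)) * e2
  simp only [e, branchDensity]
  rw [div_div, mul_assoc 2]

theorem continuousOn_charLine_div (H : ShockSetup u xs ts tf T U) :
    ContinuousOn (fun τ => side σ * charLine u xs σ τ t0 /
        ((sideVel u xs false tf - sideVel u xs true tf) * (tf - t0))) (Icc ts tf) := by
  have h1 := H.continuousOn_curve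
  have h2 := H.continuousOn_sideVel (σ := σ)
  simp only [charLine]
  fun_prop

theorem branchDensity_nonneg (H : ShockSetup u xs ts tf T U) (ht0 : 0 ≤ t0) (h0s : t0 < ts)
    (hτ : τ ∈ Ioc ts tf) : 0 ≤ branchDensity u xs t0 tf σ τ := by
  refine nonneg_of_hasDerivAt_of_forall_le (H.hasDerivAt_charLine_div hτ) hτ.1 fun s hs => ?_
  refine div_le_div_of_nonneg_right ?_ (H.denominator_pos h0s).le
  have := H.side_mul_charLine_sub_pos_of_lt (σ := σ) hs.1 hs.2 hτ.2 ⟨ht0, h0s.trans hs.1⟩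
  linarith

theorem integrableOn_branchDensity (H : ShockSetup u xs ts tf T U) (ht0 : 0 ≤ t0) (h0s : t0 < ts) :
    IntegrableOn (branchDensity u xs t0 tf σ) (Icc ts tf) := by
  rw [integrableOn_Icc_iff_integrableOn_Ioc]
  exact intervalIntegral.integrableOn_deriv_of_nonneg H.continuousOn_charLine_div
    (fun τ hτ => H.hasDerivAt_charLine_div (Ioo_subset_Ioc_self hτ))
    fun τ hτ => H.branchDensity_nonneg ht0 h0s (Ioo_subset_Ioc_self hτ)

/-- The product of the mass absorbed by time `τ` and the shock velocity at time `τ`, relative to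
the total mass. -/
noncomputable def absorbedMomentum (u : ℝ → ℝ → ℝ) (xs : ℝ → ℝ) (t0 tf τ : ℝ) : ℝ :=
  shockVel u xs τ * ((sideVel u xs false τ - sideVel u xs true τ) * (τ - t0)) /
    ((sideVel u xs false tf - sideVel u xs true tf) * (tf - t0))

theorem continuousOn_absorbedMomentum (H : ShockSetup u xs ts tf T U) :
    ContinuousOn (absorbedMomentum u xs t0 tf) (Icc ts tf) := by
  have h1 := H.continuousOn_sideVel (σ := false)
  have h2 := H.continuousOn_sideVel (σ := true)
  unfold absorbedMomentum shockVel
  fun_prop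

/-- Conservation of momentum: the momentum of the shock grows by that of the particles it
absorbs. -/
theorem hasDerivAt_absorbedMomentum (H : ShockSetup u xs ts tf T U) (hτ : τ ∈ Ioc ts tf) :
    HasDerivAt (absorbedMomentum u xs t0 tf)
      (∑ σ, branchDensity u xs t0 tf σ τ * sideVel u xs σ τ) τ := by
  have h1 := H.hasDerivAt_sideVel (σ := false) hτ
  have h2 := H.hasDerivAt_sideVel (σ := true) hτ
  have h3 := (((h1.add h2).div_const 2).mul
    ((h1.sub h2).mul ((hasDerivAt_id τ).sub_const t0))).div_const
    ((sideVel u xs false tf - sideVel u xs true tf) * (tf - t0))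
  refine h3.congr_deriv ?_
  simp only [Fintype.sum_bool, branchDensity, shockVel, Pi.add_apply, Pi.sub_apply, Pi.mul_apply,
    id, mul_assoc (2 : ℝ), div_mul_eq_div_div]
  ring

theorem absorbedMomentum_tf (H : ShockSetup u xs ts tf T U) (h0s : t0 < ts) :
    absorbedMomentum u xs t0 tf tf = shockVel u xs tf :=
  mul_div_cancel_right₀ _ (H.denominator_pos h0s).ne'

/-- The total probability of branching by time `s`. -/
theorem sum_integral_branchDensity (H : ShockSetup u xs ts tf T U) (ht0 : 0 ≤ t0) (h0s : t0 < ts)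
    {s : ℝ} (hs : s ∈ Icc ts tf) :
    ∑ σ, ∫ τ in ts..s, branchDensity u xs t0 tf σ τ =
      (sideVel u xs false s - sideVel u xs true s) * (s - t0) /
        ((sideVel u xs false tf - sideVel u xs true tf) * (tf - t0)) := by
  have h : ∀ σ, ∫ τ in ts..s, branchDensity u xs t0 tf σ τ = _ := fun σ =>
    intervalIntegral.integral_eq_sub_of_hasDerivAt_of_le hs.1
      (H.continuousOn_charLine_div.mono (Icc_subset_Icc_right hs.2))
      (fun τ hτ => H.hasDerivAt_charLine_div ⟨hτ.1, hτ.2.le.trans hs.2⟩)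
      ((intervalIntegrable_iff_integrableOn_Icc_of_le hs.1).2
        ((H.integrableOn_branchDensity (σ := σ) ht0 h0s).mono_set (Icc_subset_Icc_right hs.2)))
  simp only [h, Fintype.sum_bool]
  rw [← sub_div, ← sub_div, ← add_div]
  congr 1
  simp only [charLine, side, H.sideVel_ts]
  ring

end ShockSetup

/-! ### Expectations under the law of the process -/

theorem count_bool_prod {α : Type*} [MeasurableSpace α] (μ : Measure α) [SFinite μ] :
    (Measure.count : Measure Bool).prod μ = μ.map (Prod.mk true) + μ.map (Prod.mk false) := by
  have h : (Measure.count : Measure Bool) = Measure.dirac true + Measure.dirac false := by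
    rw [Measure.count, Measure.sum_fintype, Fintype.sum_bool]
  rw [h, Measure.add_prod, Measure.dirac_prod, Measure.dirac_prod]

theorem integrable_and_integral_withDensity_count_bool_prod {α : Type*} [MeasurableSpace α]
    {μ : Measure α} [SFinite μ] {p h : Bool × α → ℝ}
    (hp : ∀ σ, Integrable (fun x => p (σ, x)) μ) (hp0 : ∀ σ, ∀ᵐ x ∂μ, 0 ≤ p (σ, x))
    (hph : ∀ σ, Integrable (fun x => p (σ, x) * h (σ, x)) μ) :
    Integrable h ((((Measure.count : Measure Bool).prod μ)).withDensity
        fun ω => ENNReal.ofReal (p ω)) ∧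
      ∫ ω, h ω ∂(((Measure.count : Measure Bool).prod μ).withDensity
        fun ω => ENNReal.ofReal (p ω)) = ∑ σ, ∫ x, p (σ, x) * h (σ, x) ∂μ := by
  have hemb : ∀ σ : Bool, MeasurableEmbedding (Prod.mk σ : α → Bool × α) :=
    fun σ => measurableEmbedding_prodMk_left σ
  have hm : AEMeasurable (fun ω => ENNReal.ofReal (p ω))
      ((Measure.count : Measure Bool).prod μ) := by
    rw [count_bool_prod, aemeasurable_add_measure_iff, (hemb _).aemeasurable_map_iff,
      (hemb _).aemeasurable_map_iff]
    exact ⟨(hp true).aemeasurable.ennreal_ofReal, (hp false).aemeasurable.ennreal_ofReal⟩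
  have hlt : ∀ᵐ ω ∂(Measure.count : Measure Bool).prod μ, ENNReal.ofReal (p ω) < ⊤ :=
    ae_of_all _ fun _ => ENNReal.ofReal_lt_top
  have hcongr : ∀ σ, (fun x => p (σ, x) * h (σ, x)) =ᵐ[μ]
      fun x => (ENNReal.ofReal (p (σ, x))).toReal • h (σ, x) := fun σ => by
    filter_upwards [hp0 σ] with x hx
    rw [ENNReal.toReal_ofReal hx, smul_eq_mul]
  have hi : ∀ σ, Integrable (fun ω : Bool × α => (ENNReal.ofReal (p ω)).toReal • h ω)
      (μ.map (Prod.mk σ)) := fun σ =>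
    (hemb σ).integrable_map_iff.2 ((hph σ).congr (hcongr σ))
  constructor
  · rw [integrable_withDensity_iff_integrable_smul₀' hm hlt, count_bool_prod]
    exact (hi true).add_measure (hi false)
  · rw [integral_withDensity_eq_integral_toReal_smul₀ hm hlt, count_bool_prod,
      integral_add_measure (hi true) (hi false), (hemb _).integral_map, (hemb _).integral_map,
      Fintype.sum_bool, integral_congr_ae (hcongr true), integral_congr_ae (hcongr false)]

namespace ShockSetup

variable {t0 : ℝ}

/-- Expectations under the law of the process, as integrals over the branching time. -/
theorem integrable_and_integral_law (H : ShockSetup u xs ts tf T U) (ht0 : 0 ≤ t0) (h0s : t0 < ts)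
    {h : Bool × ℝ → ℝ}
    (hh : ∀ σ, IntegrableOn (fun τ => branchDensity u xs t0 tf σ τ * h (σ, τ)) (Ioc ts tf)) :
    Integrable h (law u xs t0 ts tf) ∧ ∫ ω, h ω ∂(law u xs t0 ts tf) =
      ∑ σ, ∫ τ in Ioc ts tf, branchDensity u xs t0 tf σ τ * h (σ, τ) := by
  rw [law, ← restrict_Ioc_eq_restrict_Icc]
  refine integrable_and_integral_withDensity_count_bool_prod
    (p := fun ω => branchDensity u xs t0 tf ω.1 ω.2) (fun σ => ?_) (fun σ => ?_) hh
  · exact (H.integrableOn_branchDensity ht0 h0s).mono_set Ioc_subset_Icc_self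
  · exact ae_restrict_of_forall_mem measurableSet_Ioc fun τ hτ => H.branchDensity_nonneg ht0 h0s hτ

theorem isProbabilityMeasure_law (H : ShockSetup u xs ts tf T U) (ht0 : 0 ≤ t0) (h0s : t0 < ts) :
    IsProbabilityMeasure (law u xs t0 ts tf) := by
  obtain ⟨-, h2⟩ := H.integrable_and_integral_law ht0 h0s (h := fun _ => 1) fun σ => by
    simpa using (H.integrableOn_branchDensity ht0 h0s).mono_set Ioc_subset_Icc_self
  have h3 := H.sum_integral_branchDensity ht0 h0s (right_mem_Icc.2 H.ts_lt_tf.le)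
  rw [div_self (H.denominator_pos h0s).ne'] at h3
  simp only [intervalIntegral.integral_of_le H.ts_lt_tf.le] at h3
  simp only [mul_one, h3] at h2
  rw [integral_const, smul_eq_mul, mul_one] at h2
  exact ⟨(ENNReal.toReal_eq_one_iff _).1 h2⟩

theorem integrable_and_integral_velocity (H : ShockSetup u xs ts tf T U) (ht0 : 0 ≤ t0)
    (h0s : t0 < ts) (ht : t ∈ Icc 0 tf) :
    Integrable (velocity u xs t) (law u xs t0 ts tf) ∧
      ∫ ω, velocity u xs t ω ∂(law u xs t0 ts tf) = shockVel u xs tf := by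
  set s : ℝ := max ts t with hs
  have hsm : s ∈ Icc ts tf := ⟨le_max_left _ _, max_le H.ts_lt_tf.le ht.2⟩
  have hp := fun σ => H.integrableOn_branchDensity (σ := σ) ht0 h0s
  -- the realizations that are on the shock at time `t` are those with branching time at most `s`
  have h1 : ∀ σ, EqOn (fun τ => branchDensity u xs t0 tf σ τ * velocity u xs t (σ, τ))
      (fun τ => branchDensity u xs t0 tf σ τ * shockVel u xs s) (Ioc ts s) := by
    intro σ τ hτ
    have hst : s = t := max_eq_right (le_of_not_ge fun h => by
      rw [hs, max_eq_left h] at hτ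
      exact absurd hτ.1 (not_lt.2 hτ.2))
    simp only [H.velocity_eq (ω := (σ, τ)) ⟨hτ.1.le, hτ.2.trans hsm.2⟩ ht, branchVel]
    rw [if_pos (hτ.2.trans hst.le), hst]
  have h2 : ∀ σ, EqOn (fun τ => branchDensity u xs t0 tf σ τ * velocity u xs t (σ, τ))
      (fun τ => branchDensity u xs t0 tf σ τ * sideVel u xs σ τ) (Ioc s tf) := by
    intro σ τ hτ
    simp only [H.velocity_eq (ω := (σ, τ)) ⟨hsm.1.trans hτ.1.le, hτ.2⟩ ht, branchVel]
    rw [if_neg (not_le.2 ((le_max_right _ _).trans_lt hτ.1))]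
  have hi1 : ∀ σ, IntegrableOn (fun τ => branchDensity u xs t0 tf σ τ * shockVel u xs s)
      (Ioc ts s) := fun σ =>
    ((hp σ).mono_set ((Ioc_subset_Icc_self).trans (Icc_subset_Icc_right hsm.2))).mul_const _
  have hi2 : ∀ σ, IntegrableOn (fun τ => branchDensity u xs t0 tf σ τ * sideVel u xs σ τ)
      (Ioc s tf) := fun σ =>
    ((hp σ).mul_continuousOn H.continuousOn_sideVel isCompact_Icc).mono_set
      ((Ioc_subset_Icc_self).trans (Icc_subset_Icc_left hsm.1))
  have hi1' := fun σ => (hi1 σ).congr_fun (h1 σ).symm measurableSet_Ioc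
  have hi2' := fun σ => (hi2 σ).congr_fun (h2 σ).symm measurableSet_Ioc
  have hunion : Ioc ts tf = Ioc ts s ∪ Ioc s tf := (Ioc_union_Ioc_eq_Ioc hsm.1 hsm.2).symm
  obtain ⟨hI, hE⟩ := H.integrable_and_integral_law ht0 h0s (h := velocity u xs t) fun σ => by
    rw [hunion]
    exact (hi1' σ).union (hi2' σ)
  refine ⟨hI, ?_⟩
  have hsplit : ∀ σ, ∫ τ in Ioc ts tf, branchDensity u xs t0 tf σ τ * velocity u xs t (σ, τ) =
      (∫ τ in ts..s, branchDensity u xs t0 tf σ τ) * shockVel u xs s +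
        ∫ τ in s..tf, branchDensity u xs t0 tf σ τ * sideVel u xs σ τ := by
    intro σ
    rw [hunion, setIntegral_union (Ioc_disjoint_Ioc_of_le le_rfl) measurableSet_Ioc (hi1' σ)
      (hi2' σ), setIntegral_congr_fun measurableSet_Ioc (h1 σ),
      setIntegral_congr_fun measurableSet_Ioc (h2 σ), integral_mul_const,
      intervalIntegral.integral_of_le hsm.1, intervalIntegral.integral_of_le hsm.2]
  have hi3 : ∀ σ, IntervalIntegrable (fun τ => branchDensity u xs t0 tf σ τ * sideVel u xs σ τ)
      volume s tf := fun σ => (intervalIntegrable_iff_integrableOn_Ioc_of_le hsm.2).2 (hi2 σ)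
  have hmom := intervalIntegral.integral_eq_sub_of_hasDerivAt_of_le hsm.2
    ((H.continuousOn_absorbedMomentum (t0 := t0)).mono (Icc_subset_Icc_left hsm.1))
    (fun τ hτ => H.hasDerivAt_absorbedMomentum ⟨hsm.1.trans_lt hτ.1, hτ.2.le⟩)
    (by simpa only [Fintype.sum_bool] using (hi3 true).add (hi3 false))
  rw [intervalIntegral.integral_finsetSum fun σ _ => hi3 σ] at hmom
  rw [hE]
  simp only [hsplit]
  rw [Finset.sum_add_distrib, ← Finset.sum_mul, H.sum_integral_branchDensity ht0 h0s hsm, hmom,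
    H.absorbedMomentum_tf h0s, absorbedMomentum]
  ring

end ShockSetup

end BurgersShock

open BurgersShock in
theorem proposition3p1 (u : ℝ → ℝ → ℝ) (xs : ℝ → ℝ) (t0 ts tf T : ℝ)
    (ht0 : 0 ≤ t0) (h0s : t0 < ts) (hsf : ts < tf) (hfT : tf < T)
    (hu : IsWeakSolution u T) (hs : IsSingleShock u xs ts tf T) :
    -- the assigned branching densities define a probability law
    (∀ σ, ∀ τ ∈ Ioc ts tf, 0 ≤ branchDensity u xs t0 tf σ τ) ∧
    IsProbabilityMeasure (law u xs t0 ts tf) ∧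
    -- every realization has the right-hand velocity `ū(x(t), t)`
    (∀ ω : Bool × ℝ, ω.2 ∈ Icc ts tf → ∀ t ∈ Icc 0 tf,
      HasDerivWithinAt (path u xs ω) (uBar u (path u xs ω t) t) (Ici t) t) ∧
    -- the expected velocity is constant in time
    (∀ t ∈ Icc 0 tf, Integrable (velocity u xs t) (law u xs t0 ts tf) ∧
      ∫ ω, velocity u xs t ω ∂(law u xs t0 ts tf) = shockVel u xs tf) := by
  obtain ⟨U, hU, hsub, hcont, hdiff⟩ := hs.regular
  have H : ShockSetup u xs ts tf T U :=
    ⟨ht0.trans_lt h0s, hsf, hfT, hu, hs, hU, hsub, hcont, hdiff⟩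
  refine ⟨fun σ τ hτ => H.branchDensity_nonneg ht0 h0s hτ, H.isProbabilityMeasure_law ht0 h0s,
    fun ω hω t ht => ?_, fun t ht => H.integrable_and_integral_velocity ht0 h0s ht⟩
  rw [H.uBar_path hω ht]
  exact H.hasDerivWithinAt_path hω ht
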